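/- For $n\in\mathbb N=\{1,2,\dots\}$ and $c=(c_1,\dots,c_{n-1})\in\{\pm1\}^{n-1}$ let $A_n^c$ be the $n\times n$ tridiagonal matrix with zero diagonal, all entries $1$ on the first superdiagonal and entries $c_1,\dots,c_{n-1}$ on the first subdiagonal (so $A_1^c=(0)$). For $b\in\{\pm1\}^{\mathbb Z}$ let $A^b$ be the bounded operator on $\ell^2(\mathbb Z)$ given by $(A^bx)_i=b_{i-1}x_{i-1}+x_{i+1}$. For $\varepsilon>0$ and a bounded operator (or square matrix) $B$, let $$\operatorname{spec}^2_\varepsilon B=\operatorname{spec}B\cup\{\lambda\in\mathbb C:\|(B-\lambda I)^{-1}\|_2>\varepsilon^{-1}\},$$ where $\|\cdot\|_2$ is the operator norm induced by the $\ell^2$ norm (the Euclidean norm for matrices). Put $$\Sigma=\bigcup_{b\in\{\pm1\}^{\mathbb Z}}\operatorname{spec}A^b,\quad \Sigma^2_\varepsilon=\bigcup_{b\in\{\pm1\}^{\mathbb Z}}\operatorname{spec}^2_\varepsilon A^b,\quad \sigma_n=\bigcup_{c\in\{\pm1\}^{n-1}}\operatorname{spec}A_n^c,\quad \sigma^2_{n,\varepsilon}=\bigcup_{c\in\{\pm1\}^{n-1}}\operatorname{spec}^2_\varepsilon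 A_n^c .$$ Let $\varepsilon_n=4\sin\theta_n$, where $\theta_n$ is the unique solution in $\left(\frac{\pi}{2(n+3)},\frac{\pi}{2(n+2)}\right]$ of $2\cos((n+1)\theta)=\cos((n-1)\theta)$. Let $\mathbb D$ be the open unit disc. For $T_n,T\subset\mathbb C$ write $T_n\searrow T$ (respectively $T_n\nearrow T$) if $T\subset T_n$ (respectively $T_n\subset T$) for every $n\in\mathbb N$ and the Hausdorff distance $\max\bigl(\sup_{z\in T}\operatorname{dist}(z,T_n),\sup_{z\in T_n}\operatorname{dist}(z,T)\bigr)$ tends to $0$ as $n\to\infty$. **Theorem 4.9.** For every $n\in\mathbb N$ we have $0<\varepsilon_n\le 2\pi/(n+2)$, and, for every $\varepsilon>0$, $$\sigma_n\subset\Sigma\subset\overline{\sigma^2_{n,\varepsilon_n}}\subset\overline{\Sigma^2_{\varepsilon_n}}\quad\text{and}\quad \Sigma^2_\varepsilon\subset\sigma^2_{n,\varepsilon+\varepsilon_n}\subset\Sigma^2_{\varepsilon+\varepsilon_n}.$$ Further, $$\sigma_n+\varepsilon\mathbb D\subset\Sigma^2_\varepsilon\ \text{ for }\varepsilon>0,\quad\text{and}\quad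 \Sigma^2_{\varepsilon-\varepsilon_n}\subset\sigma^2_{n,\varepsilon}\subset\Sigma^2_\varepsilon\ \text{ for }\varepsilon>\varepsilon_n.$$ Moreover, as $n\to\infty$, $\overline{\sigma^2_{n,\varepsilon_n}}\searrow\Sigma$ and, for every $\varepsilon>0$, $\sigma^2_{n,\varepsilon+\varepsilon_n}\searrow\Sigma^2_\varepsilon$ and $\sigma^2_{n,\varepsilon}\nearrow\Sigma^2_\varepsilon$. -/

import Mathlib

open Filter Topology Set
open scoped ENNReal Pointwise

namespace HoppingSign

noncomputable section

/-! ### The bi-infinite operators `A^b` on `ℓ²(ℤ)` -/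

/-- The Hilbert space `ℓ²(ℤ)` of complex square-summable bi-infinite sequences. -/
abbrev EllTwo : Type := lp (fun _ : ℤ => ℂ) 2

theorem memlp_of_norm_eq_shift (k : ℤ) (x : EllTwo) (y : ℤ → ℂ)
    (h : ∀ j, ‖y j‖ = ‖x (j - k)‖) : Memℓp y 2 := by
  have h2 : (0 : ℝ) < (2 : ℝ≥0∞).toReal := by norm_num
  rw [memℓp_gen_iff h2]
  have hs := (lp.memℓp x).summable h2
  have := (Equiv.subRight k).summable_iff.mpr hs
  refine this.congr fun j => ?_
  simp [h j]

theorem norm_eq_of_norm_eq_shift (k : ℤ) (x y : EllTwo)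
    (h : ∀ j, ‖y j‖ = ‖x (j - k)‖) : ‖y‖ = ‖x‖ := by
  have h2 : (0 : ℝ) < (2 : ℝ≥0∞).toReal := by norm_num
  rw [lp.norm_eq_tsum_rpow h2, lp.norm_eq_tsum_rpow h2,
    ← (Equiv.subRight k).tsum_eq (fun j => ‖x j‖ ^ (2 : ℝ≥0∞).toReal)]
  simp [h]

/-- The shift `V_k` on `ℓ²(ℤ)`: `(V_k y)_j = y_{j-k}`. -/
def shift (k : ℤ) : EllTwo →L[ℂ] EllTwo :=
  LinearIsometry.toContinuousLinearMap
    { toFun := fun x => ⟨fun j => x (j - k), memlp_of_norm_eq_shift k x _ fun _ => rfl⟩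
      map_add' := fun _ _ => rfl
      map_smul' := fun _ _ => rfl
      norm_map' := fun x => norm_eq_of_norm_eq_shift k x _ fun _ => rfl }

theorem norm_sign_mul (s : ℤˣ) (z : ℂ) : ‖((s : ℤ) : ℂ) * z‖ = ‖z‖ := by
  rcases Int.units_eq_one_or s with rfl | rfl <;> simp

/-- Multiplication `M_b` on `ℓ²(ℤ)` by `b ∈ {±1}^ℤ`: `(M_b y)_j = b_j y_j`. The set `{±1}` is
the unit group `ℤˣ`. -/
def signMul (b : ℤ → ℤˣ) : EllTwo →L[ℂ] EllTwo :=
  LinearIsometry.toContinuousLinearMap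
    { toFun := fun x => ⟨fun j => ((b j : ℤ) : ℂ) * x j,
        memlp_of_norm_eq_shift 0 x _ fun j => by rw [norm_sign_mul, sub_zero]⟩
      map_add' := fun x y => lp.ext (funext fun j => mul_add _ (x j) (y j))
      map_smul' := fun c x => lp.ext (funext fun j => mul_left_comm _ c (x j))
      norm_map' := fun x => norm_eq_of_norm_eq_shift 0 x _ fun j => by
        rw [sub_zero]; exact norm_sign_mul (b j) (x j) }

/-- The operator `A^b = V_1 M_b + V_{-1}` on `ℓ²(ℤ)`. -/
def hoppingOp (b : ℤ → ℤˣ) : EllTwo →L[ℂ] EllTwo :=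
  shift 1 ∘L signMul b + shift (-1)

/-- `(A^b x)_i = b_{i-1} x_{i-1} + x_{i+1}`. -/
theorem hoppingOp_apply (b : ℤ → ℤˣ) (x : EllTwo) (i : ℤ) :
    hoppingOp b x i = ((b (i - 1) : ℤ) : ℂ) * x (i - 1) + x (i + 1) := by
  change ((b (i - 1) : ℤ) : ℂ) * x (i - 1) + x (i - -1) = _
  rw [sub_neg_eq_add]

/-! ### The finite matrices `A_n^c` -/

/-- The `n × n` matrix `A_n^c`, `c ∈ {±1}^{n-1}`: ones on the first superdiagonal, the entries
of `c` on the first subdiagonal, and zeros elsewhere. -/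
def hoppingMatrix (n : ℕ) (c : Fin (n - 1) → ℤˣ) : Matrix (Fin n) (Fin n) ℂ :=
  Matrix.of fun i j =>
    if (j : ℕ) = i + 1 then 1
    else if h : (i : ℕ) = j + 1 then ((c ⟨j, by omega⟩ : ℤ) : ℂ)
    else 0

/-! ### Pseudospectra -/

/-- The `ε`-pseudospectrum
`spec_ε B = spec B ∪ {λ : ‖(B - λ I)⁻¹‖ > ε⁻¹}` of a bounded operator `B`. -/
def pseudospectrum {E : Type*} [NormedAddCommGroup E] [NormedSpace ℂ E]
    (ε : ℝ) (B : E →L[ℂ] E) : Set ℂ :=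
  spectrum ℂ B ∪ {z : ℂ | ε⁻¹ < ‖Ring.inverse (B - algebraMap ℂ (E →L[ℂ] E) z)‖}

/-- The 2-norm `ε`-pseudospectrum of a square matrix, viewed as an operator on Euclidean
space `ℂⁿ`. -/
def matrixPseudospectrum {n : ℕ} (ε : ℝ) (M : Matrix (Fin n) (Fin n) ℂ) : Set ℂ :=
  pseudospectrum ε (Matrix.toEuclideanCLM (𝕜 := ℂ) M)

/-- `Σ`, the union of `spec A^b` over all `b ∈ {±1}^ℤ`. -/
def bigSigma : Set ℂ := ⋃ b : ℤ → ℤˣ, spectrum ℂ (hoppingOp b)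

/-- `Σ_ε^2`, the union of the `ℓ²` `ε`-pseudospectra of `A^b` over all `b ∈ {±1}^ℤ`. -/
def bigSigmaEps (ε : ℝ) : Set ℂ := ⋃ b : ℤ → ℤˣ, pseudospectrum ε (hoppingOp b)

/-- `σ_n`, the union of `spec A_n^c` over all `c ∈ {±1}^{n-1}`. -/
def sigma (n : ℕ) : Set ℂ := ⋃ c : Fin (n - 1) → ℤˣ, spectrum ℂ (hoppingMatrix n c)

/-- `σ_{n,ε}^2`, the union of the 2-norm `ε`-pseudospectra of `A_n^c` over all
`c ∈ {±1}^{n-1}`. -/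
def sigmaEps (n : ℕ) (ε : ℝ) : Set ℂ :=
  ⋃ c : Fin (n - 1) → ℤˣ, matrixPseudospectrum ε (hoppingMatrix n c)

/-! ### The numbers `θ_n` and `ε_n` -/

/-- `θ` lies in `(π/(2(n+3)), π/(2(n+2))]` and solves `2 cos((n+1)θ) = cos((n-1)θ)`. -/
def IsTheta (n : ℕ) (θ : ℝ) : Prop :=
  θ ∈ Ioc (Real.pi / (2 * ((n : ℝ) + 3))) (Real.pi / (2 * ((n : ℝ) + 2))) ∧
    2 * Real.cos (((n : ℝ) + 1) * θ) = Real.cos (((n : ℝ) - 1) * θ)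

theorem existsUnique_isTheta (n : ℕ) (hn : 1 ≤ n) : ∃! θ : ℝ, IsTheta n θ := by
  have hpi := Real.pi_pos
  have hn1 : (1 : ℝ) ≤ n := by exact_mod_cast hn
  set a : ℝ := Real.pi / (2 * ((n : ℝ) + 3)) with ha
  set b : ℝ := Real.pi / (2 * ((n : ℝ) + 2)) with hb
  have ha' : ((n : ℝ) + 3) * a = Real.pi / 2 := by rw [ha]; field_simp
  have hb' : ((n : ℝ) + 2) * b = Real.pi / 2 := by rw [hb]; field_simp
  have ha0 : 0 < a := by positivity
  have hb0 : 0 < b := by positivity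
  have hab : a < b := by nlinarith
  let f : ℝ → ℝ := fun θ =>
    2 * Real.cos (((n : ℝ) + 1) * θ) - Real.cos (((n : ℝ) - 1) * θ)
  have hf : Continuous f := by fun_prop
  have hfa : 0 < f a := by
    have e1 : ((n : ℝ) + 1) * a = Real.pi / 2 - 2 * a := by linarith
    have e2 : ((n : ℝ) - 1) * a = Real.pi / 2 - 2 * (2 * a) := by linarith
    have hs : 0 < Real.sin (2 * a) :=
      Real.sin_pos_of_pos_of_lt_pi (by linarith) (by nlinarith)
    have hc : Real.cos (2 * a) < 1 := by
      rw [← Real.cos_zero]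
      exact Real.cos_lt_cos_of_nonneg_of_le_pi le_rfl (by nlinarith) (by linarith)
    simp only [f]
    rw [e1, e2, Real.cos_pi_div_two_sub, Real.cos_pi_div_two_sub, Real.sin_two_mul (2 * a)]
    nlinarith
  have hfb : f b ≤ 0 := by
    have e1 : ((n : ℝ) + 1) * b = Real.pi / 2 - b := by linarith
    have e2 : ((n : ℝ) - 1) * b = Real.pi / 2 - 3 * b := by linarith
    have hs : 0 < Real.sin b := Real.sin_pos_of_pos_of_lt_pi hb0 (by nlinarith)
    have hs' : Real.sin b ≤ 1 / 2 := by
      rw [← Real.sin_pi_div_six]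
      exact Real.sin_le_sin_of_le_of_le_pi_div_two (by linarith) (by linarith) (by nlinarith)
    simp only [f]
    rw [e1, e2, Real.cos_pi_div_two_sub, Real.cos_pi_div_two_sub, Real.sin_three_mul]
    have h4 : Real.sin b ^ 2 ≤ 1 / 4 := by nlinarith
    nlinarith
  have hanti : StrictAntiOn f (Icc a b) := by
    refine strictAntiOn_of_deriv_neg (convex_Icc a b) hf.continuousOn fun x hx => ?_
    rw [interior_Icc] at hx
    have hd : HasDerivAt f (2 * (-Real.sin (((n : ℝ) + 1) * x) * (((n : ℝ) + 1) * 1)) -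
        (-Real.sin (((n : ℝ) - 1) * x) * (((n : ℝ) - 1) * 1))) x :=
      ((((hasDerivAt_id x).const_mul ((n : ℝ) + 1)).cos).const_mul 2).sub
        (((hasDerivAt_id x).const_mul ((n : ℝ) - 1)).cos)
    rw [hd.deriv]
    have hx0 : 0 < x := ha0.trans hx.1
    have hx1 : ((n : ℝ) + 1) * x ≤ Real.pi / 2 := by nlinarith [hx.2]
    have hx2 : 0 ≤ ((n : ℝ) - 1) * x := mul_nonneg (by linarith) hx0.le
    have hle : Real.sin (((n : ℝ) - 1) * x) ≤ Real.sin (((n : ℝ) + 1) * x) :=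
      Real.sin_le_sin_of_le_of_le_pi_div_two (by linarith) hx1 (by nlinarith)
    have hpos : 0 < Real.sin (((n : ℝ) + 1) * x) :=
      Real.sin_pos_of_pos_of_lt_pi (by positivity) (by linarith)
    nlinarith [mul_le_mul_of_nonneg_left hle (sub_nonneg.mpr hn1)]
  obtain ⟨θ, hθ, hθ0⟩ := intermediate_value_Icc' hab.le hf.continuousOn ⟨hfb, hfa.le⟩
  have hne : a ≠ θ := by
    rintro rfl
    exact hfa.ne' hθ0
  refine ⟨θ, ⟨⟨lt_of_le_of_ne hθ.1 hne, hθ.2⟩, sub_eq_zero.mp hθ0⟩, ?_⟩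
  rintro φ ⟨hφ, hφ0⟩
  exact hanti.injOn ⟨hφ.1.le, hφ.2⟩ hθ ((sub_eq_zero.mpr hφ0).trans hθ0.symm)

/-- `θ_n` for `n ≥ 1`, the unique solution of `2 cos((n+1)θ) = cos((n-1)θ)` in the interval
`(π/(2(n+3)), π/(2(n+2))]` (and `0` for `n = 0`, a value that is never used). -/
def theta (n : ℕ) : ℝ :=
  if hn : 1 ≤ n then (existsUnique_isTheta n hn).choose else 0

theorem isTheta_theta (n : ℕ) (hn : 1 ≤ n) : IsTheta n (theta n) := by
  rw [theta, dif_pos hn]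
  exact (existsUnique_isTheta n hn).choose_spec.1

/-- `ε_n = 4 sin θ_n`. -/
def epsSeq (n : ℕ) : ℝ := 4 * Real.sin (theta n)

/-! ### Monotone convergence of sets -/

/-- `T_n ↗ T`: `T_n ⊆ T` for each `n ∈ {1, 2, …}`, and the Hausdorff distance of `T_n` and `T`
tends to `0`. -/
def IncreasesTo (T : ℕ → Set ℂ) (S : Set ℂ) : Prop :=
  (∀ n, 1 ≤ n → T n ⊆ S) ∧
    Tendsto (fun n => Metric.hausdorffEDist (T n) S) atTop (𝓝 0)

/-- `T_n ↘ T`: `T ⊆ T_n` for each `n ∈ {1, 2, …}`, and the Hausdorff distance of `T_n` and `T`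
tends to `0`. -/
def DecreasesTo (T : ℕ → Set ℂ) (S : Set ℂ) : Prop :=
  (∀ n, 1 ≤ n → S ⊆ T n) ∧
    Tendsto (fun n => Metric.hausdorffEDist (T n) S) atTop (𝓝 0)

end

end HoppingSign

namespace HoppingSign

/-! ### Approximate eigenvectors -/

section ApproxSpectrum

variable {E : Type*} [NormedAddCommGroup E]

/-! Everything is expressed through approximate eigenvectors, vectors `x` with `‖(B - z)x‖ < ε‖x‖`.
For matrices they describe the pseudospectrum exactly. For a single `A^b` they can miss points where
only surjectivity fails, but a vector orthogonal to the range, conjugated and reflected, is an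
eigenvector for the reflected sign sequence, so the union over `b` misses nothing
(`spectrum_hoppingOp_subset`). Finitely supported vectors suffice, so one sequence containing every
finite word realises the whole union (`bigSigmaEps_eq_approxSpectrum`).

From matrices to operators: a finite approximate eigenvector is reflected again and again, with
signs that create no residual at the seams. Its squared norm doubles each time while the two end
defects stay bounded, hence become negligible (`exists_reflection`, `sigmaEps_subset_bigSigmaEps`).

From operators to matrices: `x` is cut off by weights on a window of length `n`, and the residuals
are summed over all translates of the window. Some translate must have relative residual below `ε +
η`, where `η²` is a Rayleigh quotient of the weights; cosine weights give `η = ε_n`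
(`approxSpectrum_subset_sigmaEps_of_weights`, `weight_sum_eq`).

The closures rest on the absence of plateaus of the resolvent norm (`mem_closure_approxSpectrum`).
The decreasing limits add a compactness argument; the increasing one uses a finite net and the slack
in the strict inequality. -/

/-- The set of `z` for which `B - z` has an approximate eigenvector with relative residual
less than `ε`. -/
def approxSpectrum [NormedSpace ℂ E] (ε : ℝ) (B : E →L[ℂ] E) : Set ℂ :=
  {z | ∃ x : E, ‖B x - z • x‖ < ε * ‖x‖}

theorem sub_algebraMap_apply [NormedSpace ℂ E] (B : E →L[ℂ] E) (z : ℂ) (x : E) :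
    (B - algebraMap ℂ (E →L[ℂ] E) z) x = B x - z • x := by
  simp [Algebra.algebraMap_eq_smul_one]

theorem notMem_spectrum_iff_isUnit_sub [NormedSpace ℂ E] (B : E →L[ℂ] E) (z : ℂ) :
    z ∉ spectrum ℂ B ↔ IsUnit (B - algebraMap ℂ (E →L[ℂ] E) z) := by
  rw [spectrum.notMem_iff, ← IsUnit.neg_iff, neg_sub]

theorem exists_inverse_of_notMem_spectrum [NormedSpace ℂ E] {B : E →L[ℂ] E} {z : ℂ}
    (hz : z ∉ spectrum ℂ B) :
    (∀ v, B (Ring.inverse (B - algebraMap ℂ (E →L[ℂ] E) z) v) -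
        z • Ring.inverse (B - algebraMap ℂ (E →L[ℂ] E) z) v = v) ∧
      ∀ v, Ring.inverse (B - algebraMap ℂ (E →L[ℂ] E) z) (B v - z • v) = v := by
  have hu := (notMem_spectrum_iff_isUnit_sub B z).mp hz
  refine ⟨fun v => ?_, fun v => ?_⟩
  · rw [← sub_algebraMap_apply, ← mul_apply_eq_comp, Ring.mul_inverse_cancel _ hu]
    rfl
  · rw [← sub_algebraMap_apply, ← mul_apply_eq_comp, Ring.inverse_mul_cancel _ hu]
    rfl

theorem approxSpectrum_mono [NormedSpace ℂ E] (B : E →L[ℂ] E) {δ ε : ℝ} (h : δ ≤ ε) :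
    approxSpectrum δ B ⊆ approxSpectrum ε B := fun _ ⟨x, hx⟩ =>
  ⟨x, hx.trans_le (by gcongr)⟩

theorem approxSpectrum_subset_pseudospectrum [NormedSpace ℂ E] (B : E →L[ℂ] E) {ε : ℝ}
    (hε : 0 < ε) : approxSpectrum ε B ⊆ pseudospectrum ε B := by
  rintro z ⟨x, hx⟩
  by_contra hz
  simp only [pseudospectrum, mem_union, mem_ofPred_eq, not_or, not_lt] at hz
  have h2 := (exists_inverse_of_notMem_spectrum hz.1).2 x
  have h3 := ContinuousLinearMap.le_opNorm
    (Ring.inverse (B - algebraMap ℂ (E →L[ℂ] E) z)) (B x - z • x)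
  rw [h2] at h3
  have h4 : ‖x‖ ≤ ε⁻¹ * ‖B x - z • x‖ := h3.trans (by gcongr; exact hz.2)
  have h5 : ε⁻¹ * ‖B x - z • x‖ < ε⁻¹ * (ε * ‖x‖) := by gcongr
  rw [inv_mul_cancel_left₀ hε.ne'] at h5
  exact absurd h4 (not_le.mpr h5)

/-- The spectrum has to be kept on the right: an operator can be bounded below without being onto.
-/
theorem pseudospectrum_subset_union [NormedSpace ℂ E] (B : E →L[ℂ] E) {ε : ℝ} (hε : 0 < ε) :
    pseudospectrum ε B ⊆ spectrum ℂ B ∪ approxSpectrum ε B := by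
  rintro z (hz | hz)
  · exact Or.inl hz
  by_cases hs : z ∈ spectrum ℂ B
  · exact Or.inl hs
  right
  obtain ⟨h1, -⟩ := exists_inverse_of_notMem_spectrum hs
  by_contra hcon
  simp only [approxSpectrum, mem_ofPred_eq, not_exists, not_lt] at hcon
  refine absurd (ContinuousLinearMap.opNorm_le_bound _ (inv_nonneg.mpr hε.le) fun v => ?_)
    (not_le.mpr hz)
  have h2 := hcon (Ring.inverse (B - algebraMap ℂ (E →L[ℂ] E) z) v)
  rw [h1] at h2
  rwa [inv_mul_eq_div, le_div_iff₀ hε, mul_comm]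

theorem mem_spectrum_of_forall_mem_approxSpectrum [NormedSpace ℂ E] {B : E →L[ℂ] E} {z : ℂ}
    (h : ∀ δ, 0 < δ → z ∈ approxSpectrum δ B) : z ∈ spectrum ℂ B := by
  by_contra hz
  set R := Ring.inverse (B - algebraMap ℂ (E →L[ℂ] E) z) with hR
  obtain ⟨-, h2⟩ := exists_inverse_of_notMem_spectrum hz
  obtain ⟨x, hx⟩ := h (‖R‖ + 1)⁻¹ (by positivity)
  have h3 := R.le_opNorm (B x - z • x)
  rw [h2] at h3
  have hx0 : 0 ≤ ‖B x - z • x‖ := norm_nonneg _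
  rw [inv_mul_eq_div, lt_div_iff₀ (by positivity)] at hx
  nlinarith

theorem norm_le_of_mem_approxSpectrum [NormedSpace ℂ E] {B : E →L[ℂ] E} {z : ℂ} {ε : ℝ}
    (h : z ∈ approxSpectrum ε B) : ‖z‖ ≤ ‖B‖ + ε := by
  obtain ⟨x, hx⟩ := h
  have h0 : 0 < ‖x‖ := by
    rcases (norm_nonneg x).eq_or_lt with h | h
    · rw [← h, mul_zero] at hx
      exact absurd (norm_nonneg _) (not_le.mpr hx)
    · exact h
  have h1 : ‖z‖ * ‖x‖ ≤ ‖B‖ * ‖x‖ + ε * ‖x‖ := by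
    rw [← norm_smul]
    calc ‖z • x‖ = ‖B x - (B x - z • x)‖ := by congr 1; abel
      _ ≤ ‖B x‖ + ‖B x - z • x‖ := norm_sub_le _ _
      _ ≤ _ := add_le_add (B.le_opNorm x) hx.le
  rw [← add_mul] at h1
  exact le_of_mul_le_mul_right h1 h0

theorem mem_approxSpectrum_of_dist_le [NormedSpace ℂ E] {B : E →L[ℂ] E} {z w : ℂ} {δ ε : ℝ}
    (h : z ∈ approxSpectrum ε B) (hw : dist w z ≤ δ) : w ∈ approxSpectrum (ε + δ) B := by
  obtain ⟨x, hx⟩ := h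
  refine ⟨x, ?_⟩
  calc ‖B x - w • x‖ = ‖(B x - z • x) - (w - z) • x‖ := by congr 1; rw [sub_smul]; abel
    _ ≤ ‖B x - z • x‖ + ‖w - z‖ * ‖x‖ := (norm_sub_le _ _).trans_eq (by rw [norm_smul])
    _ < ε * ‖x‖ + δ * ‖x‖ := by
      refine add_lt_add_of_lt_of_le hx ?_
      rw [← dist_eq_norm]
      gcongr
    _ = _ := by ring

/-- In finite dimension a lower bound on `B - z` gives injectivity and hence invertibility, so the
spectrum adds nothing. -/
theorem pseudospectrum_eq_of_finiteDimensional [NormedSpace ℂ E] [FiniteDimensional ℂ E]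
    (B : E →L[ℂ] E) {ε : ℝ} (hε : 0 < ε) : pseudospectrum ε B = approxSpectrum ε B := by
  refine Subset.antisymm ?_ (approxSpectrum_subset_pseudospectrum B hε)
  refine (pseudospectrum_subset_union B hε).trans (union_subset ?_ subset_rfl)
  intro z hz
  by_contra hcon
  simp only [approxSpectrum, mem_ofPred_eq, not_exists, not_lt] at hcon
  refine (notMem_spectrum_iff_isUnit_sub B z).mpr ?_ hz
  have : CompleteSpace E := FiniteDimensional.complete ℂ E
  rw [ContinuousLinearMap.isUnit_iff_bijective]
  have hinj : Function.Injective (B - algebraMap ℂ (E →L[ℂ] E) z) := by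
    refine (injective_iff_map_eq_zero _).mpr fun x hx => ?_
    rw [sub_algebraMap_apply] at hx
    have := hcon x
    rw [hx, norm_zero] at this
    exact norm_le_zero_iff.mp (by nlinarith [norm_nonneg x])
  exact ⟨hinj, (LinearMap.injective_iff_surjective
    (f := ((B - algebraMap ℂ (E →L[ℂ] E) z : E →L[ℂ] E) : E →ₗ[ℂ] E))).mp hinj⟩

/-! ### Absence of plateaus of the resolvent norm -/

theorem sum_norm_sq_fourth_roots [InnerProductSpace ℂ E] (v w y : E) (r : ℝ) :
    ‖v + (r : ℂ) • w + (r : ℂ) ^ 2 • y‖ ^ 2 + ‖v + (-r : ℂ) • w + (-r : ℂ) ^ 2 • y‖ ^ 2 +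
      (‖v + (r * Complex.I) • w + (r * Complex.I) ^ 2 • y‖ ^ 2 +
        ‖v + (-(r * Complex.I)) • w + (-(r * Complex.I)) ^ 2 • y‖ ^ 2) =
      4 * (‖v‖ ^ 2 + r ^ 2 * ‖w‖ ^ 2 + r ^ 4 * ‖y‖ ^ 2) := by
  -- Averaging over the fourth roots of unity removes all cross terms between the degrees 0, 1, 2.
  -- The parallelogram law for `±r` and for `±ir` removes the odd ones, a third application the one
  -- between `v` and `y`.
  have h1 := parallelogram_law_with_norm ℂ (v + (r : ℂ) ^ 2 • y) ((r : ℂ) • w)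
  have h2 := parallelogram_law_with_norm ℂ (v - (r : ℂ) ^ 2 • y) ((r * Complex.I) • w)
  have h3 := parallelogram_law_with_norm ℂ v ((r : ℂ) ^ 2 • y)
  have e1 : v + (r : ℂ) • w + (r : ℂ) ^ 2 • y = v + (r : ℂ) ^ 2 • y + (r : ℂ) • w := by abel
  have e2 : v + (-r : ℂ) • w + (-r : ℂ) ^ 2 • y = v + (r : ℂ) ^ 2 • y - (r : ℂ) • w := by
    rw [neg_sq, neg_smul]; abel
  have hI : ((r : ℂ) * Complex.I) ^ 2 = -(r : ℂ) ^ 2 := by rw [mul_pow, Complex.I_sq]; ring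
  have e3 : v + (r * Complex.I) • w + (r * Complex.I) ^ 2 • y =
      v - (r : ℂ) ^ 2 • y + (r * Complex.I) • w := by rw [hI, neg_smul]; abel
  have e4 : v + (-(r * Complex.I)) • w + (-(r * Complex.I)) ^ 2 • y =
      v - (r : ℂ) ^ 2 • y - (r * Complex.I) • w := by
    rw [neg_sq, hI, neg_smul, neg_smul]; abel
  rw [e1, e2, e3, e4]
  have n1 : ‖(r : ℂ) • w‖ ^ 2 = r ^ 2 * ‖w‖ ^ 2 := by
    rw [norm_smul, mul_pow, Complex.norm_real, Real.norm_eq_abs, sq_abs]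
  have n2 : ‖((r : ℂ) * Complex.I) • w‖ ^ 2 = r ^ 2 * ‖w‖ ^ 2 := by
    rw [norm_smul, mul_pow, norm_mul, Complex.norm_I, mul_one, Complex.norm_real,
      Real.norm_eq_abs, sq_abs]
  have n3 : ‖(r : ℂ) ^ 2 • y‖ ^ 2 = r ^ 4 * ‖y‖ ^ 2 := by
    rw [norm_smul, mul_pow, norm_pow, Complex.norm_real, Real.norm_eq_abs, sq_abs]; ring
  rw [n1] at h1
  rw [n2] at h2
  rw [n3] at h3
  linarith

/-- Some perturbation `v + ζ w + ζ² y`, `|ζ| = r`, is at least as long as orthogonality of the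
three terms would make it. -/
theorem exists_norm_sq_le_norm_sq_perturbation [InnerProductSpace ℂ E] (v w y : E) {r : ℝ}
    (hr : 0 ≤ r) : ∃ ζ : ℂ, ‖ζ‖ = r ∧
      ‖v‖ ^ 2 + r ^ 2 * ‖w‖ ^ 2 ≤ ‖v + ζ • w + ζ ^ 2 • y‖ ^ 2 := by
  by_contra! hcon
  have hn : ‖(r : ℂ)‖ = r := by rw [Complex.norm_real, Real.norm_of_nonneg hr]
  have hnI : ‖(r * Complex.I : ℂ)‖ = r := by rw [norm_mul, Complex.norm_I, mul_one, hn]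
  have h1 := hcon r hn
  have h2 := hcon (-r) (by rw [norm_neg, hn])
  have h3 := hcon (r * Complex.I) hnI
  have h4 := hcon (-(r * Complex.I)) (by rw [norm_neg, hnI])
  have h5 := sum_norm_sq_fourth_roots v w y r
  have h6 : 0 ≤ r ^ 4 * ‖y‖ ^ 2 := by positivity
  linarith

/-- In a Hilbert space the resolvent norm has no plateaus: a point at which the smallest relative
residual is at most `ε` is a limit of points at which it is less than `ε`. -/
theorem mem_closure_approxSpectrum [InnerProductSpace ℂ E] {B : E →L[ℂ] E} {z : ℂ} {ε : ℝ}
    (hε : 0 < ε) (hz : z ∉ spectrum ℂ B) (h : ∀ δ, 0 < δ → z ∈ approxSpectrum (ε + δ) B) :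
    z ∈ closure (approxSpectrum ε B) := by
  rw [Metric.mem_closure_iff]
  intro ρ hρ
  obtain ⟨hR1, -⟩ := exists_inverse_of_notMem_spectrum hz
  set R := Ring.inverse (B - algebraMap ℂ (E →L[ℂ] E) z) with hR
  set K : ℝ := 1 + ‖R‖ ^ 2 with hK
  set D : ℝ := ‖B - algebraMap ℂ (E →L[ℂ] E) z‖ + 1 with hD
  have hD0 : 0 < D := by positivity
  -- This is the final inequality divided by `r²`: the loss in the residual is of order `r³`, the
  -- gain in squared norm of order `r²`.
  have hc : Tendsto (fun r : ℝ => D ^ 2 * (2 * ε * r * K + r ^ 4 * K ^ 2)) (𝓝[>] 0) (𝓝 0) := by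
    have : Continuous fun r : ℝ => D ^ 2 * (2 * ε * r * K + r ^ 4 * K ^ 2) := by fun_prop
    have h0 := (this.tendsto 0).mono_left (nhdsWithin_le_nhds (s := Ioi 0))
    simpa using h0
  obtain ⟨r, hr1, hr2, hr0⟩ := ((hc.eventually (gt_mem_nhds (by positivity : 0 < ε ^ 2))).and
    ((eventually_nhdsWithin_of_eventually_nhds (gt_mem_nhds hρ)).and
      self_mem_nhdsWithin)).exists
  have hr0 : 0 < r := hr0
  -- The excess over `ε` is taken as `r³` so that it, too, is dominated by the gain of order `r²`.
  obtain ⟨v, hv⟩ := h (r ^ 3) (by positivity)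
  have hv0 : 0 < ‖v‖ := by
    have := (norm_nonneg _).trans_lt hv
    exact pos_of_mul_pos_right this (by positivity)
  obtain ⟨ζ, hζ, hle⟩ := exists_norm_sq_le_norm_sq_perturbation v (R v) (R (R v)) hr0.le
  -- The vector is the Neumann series of `(1 - ζR)⁻¹ v` cut after degree two; applying `B - z - ζ`
  -- telescopes and leaves an error `ζ³ R² v`.
  refine ⟨z + ζ, ⟨v + ζ • R v + ζ ^ 2 • R (R v), ?_⟩, by simpa [hζ] using hr2⟩
  have e : B (v + ζ • R v + ζ ^ 2 • R (R v)) - (z + ζ) • (v + ζ • R v + ζ ^ 2 • R (R v)) =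
      (B v - z • v) - ζ ^ 3 • R (R v) := by
    have b1 : B (R v) = v + z • R v := eq_add_of_sub_eq (hR1 v)
    have b2 : B (R (R v)) = R v + z • R (R v) := eq_add_of_sub_eq (hR1 (R v))
    simp only [map_add, map_smul, b1, b2]
    module
  have hvR : ‖v‖ ≤ D * ‖R v‖ := by
    have := (B - algebraMap ℂ (E →L[ℂ] E) z).le_opNorm (R v)
    rw [sub_algebraMap_apply, hR1] at this
    exact this.trans (by gcongr; simp [hD])
  have hRR : ‖R (R v)‖ ≤ ‖R‖ ^ 2 * ‖v‖ := by
    calc ‖R (R v)‖ ≤ ‖R‖ * ‖R v‖ := R.le_opNorm _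
      _ ≤ ‖R‖ * (‖R‖ * ‖v‖) := by gcongr; exact R.le_opNorm _
      _ = _ := by ring
  rw [e]
  have hb : ‖(B v - z • v) - ζ ^ 3 • R (R v)‖ ≤ (ε + r ^ 3 * K) * ‖v‖ := by
    calc _ ≤ ‖B v - z • v‖ + ‖ζ ^ 3 • R (R v)‖ := norm_sub_le _ _
      _ ≤ (ε + r ^ 3) * ‖v‖ + r ^ 3 * (‖R‖ ^ 2 * ‖v‖) := by
        rw [norm_smul, norm_pow, hζ]; gcongr
      _ = _ := by rw [hK]; ring
  refine hb.trans_lt (lt_of_pow_lt_pow_left₀ 2 (by positivity) ?_)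
  rw [mul_pow ε]
  refine lt_of_lt_of_le ?_ (mul_le_mul_of_nonneg_left hle (by positivity))
  have hsq : ‖v‖ ^ 2 ≤ D ^ 2 * ‖R v‖ ^ 2 := by rw [← mul_pow]; gcongr
  have hmain : D ^ 2 * (2 * ε * r ^ 3 * K + r ^ 6 * K ^ 2) < ε ^ 2 * r ^ 2 := by
    have := mul_lt_mul_of_pos_right hr1 (by positivity : 0 < r ^ 2)
    calc _ = D ^ 2 * (2 * ε * r * K + r ^ 4 * K ^ 2) * r ^ 2 := by ring
      _ < _ := this
  have h1 : D ^ 2 * ((2 * ε * r ^ 3 * K + r ^ 6 * K ^ 2) * ‖v‖ ^ 2) <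
      D ^ 2 * (ε ^ 2 * (r ^ 2 * ‖R v‖ ^ 2)) := by
    calc _ = D ^ 2 * (2 * ε * r ^ 3 * K + r ^ 6 * K ^ 2) * ‖v‖ ^ 2 := by ring
      _ < ε ^ 2 * r ^ 2 * ‖v‖ ^ 2 := by gcongr
      _ ≤ ε ^ 2 * r ^ 2 * (D ^ 2 * ‖R v‖ ^ 2) := by gcongr
      _ = _ := by ring
  have h2 := lt_of_mul_lt_mul_left h1 (by positivity)
  calc ((ε + r ^ 3 * K) * ‖v‖) ^ 2
      = ε ^ 2 * ‖v‖ ^ 2 + (2 * ε * r ^ 3 * K + r ^ 6 * K ^ 2) * ‖v‖ ^ 2 := by ring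
    _ < ε ^ 2 * ‖v‖ ^ 2 + ε ^ 2 * (r ^ 2 * ‖R v‖ ^ 2) := by gcongr
    _ = _ := by ring

end ApproxSpectrum

/-! ### Approximate eigenvectors of `A^b` -/

section BiInfinite

/-- The `i`-th entry of `(A^b - z) X`, for an arbitrary sequence `X`. -/
def hopRes (b : ℤ → ℤˣ) (z : ℂ) (X : ℤ → ℂ) (i : ℤ) : ℂ :=
  ((b (i - 1) : ℤ) : ℂ) * X (i - 1) + X (i + 1) - z * X i

theorem hoppingOp_sub_apply (b : ℤ → ℤˣ) (z : ℂ) (x : EllTwo) (i : ℤ) :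
    (hoppingOp b x - z • x : EllTwo) i = hopRes b z x i := by
  rw [hopRes, ← hoppingOp_apply]
  rfl

theorem hasSum_norm_sq (x : EllTwo) : HasSum (fun i => ‖x i‖ ^ 2) (‖x‖ ^ 2) := by
  have h2 : (0 : ℝ) < (2 : ℝ≥0∞).toReal := by norm_num
  simpa using lp.hasSum_norm h2 x

theorem hasSum_norm_sq_shift (x : EllTwo) (j : ℤ) :
    HasSum (fun k => ‖x (k + j)‖ ^ 2) (‖x‖ ^ 2) :=
  (Equiv.addRight j).hasSum_iff.mpr (hasSum_norm_sq x)

theorem hasSum_norm_sq_hopRes (b : ℤ → ℤˣ) (z : ℂ) (x : EllTwo) (j : ℤ) :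
    HasSum (fun k => ‖hopRes b z x (k + j)‖ ^ 2) (‖hoppingOp b x - z • x‖ ^ 2) := by
  simpa only [hoppingOp_sub_apply] using hasSum_norm_sq_shift (hoppingOp b x - z • x) j

theorem norm_shift (k : ℤ) (x : EllTwo) : ‖shift k x‖ = ‖x‖ :=
  norm_eq_of_norm_eq_shift k x _ fun _ => rfl

theorem norm_signMul (b : ℤ → ℤˣ) (x : EllTwo) : ‖signMul b x‖ = ‖x‖ :=
  norm_eq_of_norm_eq_shift 0 x _ fun j => by rw [sub_zero]; exact norm_sign_mul (b j) (x j)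

theorem norm_hoppingOp_le (b : ℤ → ℤˣ) : ‖hoppingOp b‖ ≤ 2 := by
  refine ContinuousLinearMap.opNorm_le_bound _ (by norm_num) fun x => ?_
  calc ‖hoppingOp b x‖ ≤ ‖shift 1 (signMul b x)‖ + ‖shift (-1) x‖ := norm_add_le _ _
    _ = 2 * ‖x‖ := by rw [norm_shift, norm_signMul, norm_shift]; ring

/-! ### Transposition as reflection of the sign sequence -/

/-- The reflection `y ↦ (conj y_{-i})_i`. -/
theorem exists_flip (y : EllTwo) :
    ∃ Y : EllTwo, ‖Y‖ = ‖y‖ ∧ ∀ i, Y i = (starRingEnd ℂ) (y (-i)) := by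
  have h2 : (0 : ℝ) < (2 : ℝ≥0∞).toReal := by norm_num
  have hm : Memℓp (fun i : ℤ => (starRingEnd ℂ) (y (-i))) 2 := by
    rw [memℓp_gen_iff h2]
    have := (Equiv.neg ℤ).summable_iff.mpr ((lp.memℓp y).summable h2)
    refine this.congr fun j => ?_
    simp
  refine ⟨⟨_, hm⟩, ?_, fun i => rfl⟩
  have h1 := hasSum_norm_sq ⟨_, hm⟩
  have h3 := (Equiv.neg ℤ).hasSum_iff.mpr (hasSum_norm_sq y)
  have h4 : ‖(⟨_, hm⟩ : EllTwo)‖ ^ 2 = ‖y‖ ^ 2 := by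
    refine h1.unique ?_
    convert h3 using 2 with i
    simp
  exact (pow_left_inj₀ (norm_nonneg _) (norm_nonneg _) two_ne_zero).mp h4

/-- A sequence orthogonal to the range of `A^b - z` solves the transposed recurrence. -/
theorem hopRes_eq_zero_of_forall_inner_eq_zero {b : ℤ → ℤˣ} {z : ℂ} {y : EllTwo}
    (h : ∀ x : EllTwo, inner ℂ (hoppingOp b x - z • x) y = 0) (i : ℤ) :
    hopRes (fun k => b (-k - 1)) z (fun k => (starRingEnd ℂ) (y (-k))) i = 0 := by
  have h1 := h (lp.single 2 (-i) (1 : ℂ))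
  -- Testing orthogonality on the basis vector at `-i` reads off one column of `A^b - z`, which is
  -- row `i` of the reflected operator.
  have e : hoppingOp b (lp.single 2 (-i) (1 : ℂ)) - z • lp.single 2 (-i) (1 : ℂ) =
      lp.single 2 (-i + 1) (((b (-i) : ℤ) : ℂ)) + lp.single 2 (-i - 1) (1 : ℂ) -
        lp.single 2 (-i) z := by
    refine lp.ext (funext fun j => ?_)
    rw [hoppingOp_sub_apply, hopRes]
    simp only [lp.coeFn_sub, lp.coeFn_add, Pi.sub_apply, Pi.add_apply, lp.single_apply,
      Pi.single_apply]
    by_cases h1 : j = -i + 1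
    · subst h1
      simp [show -i + 1 ≠ -i - 1 by omega, show -i + 1 + 1 ≠ -i by omega]
    · have a1 : j - 1 ≠ -i := by omega
      by_cases h2 : j = -i - 1
      · subst h2
        simp [show -i - 1 - 1 ≠ -i by omega, h1]
      · have a2 : j + 1 ≠ -i := by omega
        simp [a1, a2, h1, h2]
  rw [e, inner_sub_left, inner_add_left, lp.inner_single_left, lp.inner_single_left,
    lp.inner_single_left] at h1
  have h2 := congrArg (starRingEnd ℂ) h1
  simp only [RCLike.inner_apply, map_sub, map_add, map_mul, map_zero, map_one, mul_one,
    Complex.conj_conj] at h2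
  simp only [hopRes]
  rw [show -(i - 1) - 1 = -i by ring, show -(i - 1) = -i + 1 by ring,
    show -(i + 1) = -i - 1 by ring]
  rw [← h2]
  simp [mul_comm]

/-- A lower bound for `b` gives injectivity and closed range; a lower bound for the reflected
sequence kills the orthogonal complement of the range. Both together make `A^b - z` invertible. -/
theorem spectrum_hoppingOp_subset {b : ℤ → ℤˣ} {ε : ℝ} (hε : 0 < ε) :
    spectrum ℂ (hoppingOp b) ⊆
      approxSpectrum ε (hoppingOp b) ∪ approxSpectrum ε (hoppingOp fun k => b (-k - 1)) := by
  intro z hz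
  by_contra hcon
  simp only [approxSpectrum, mem_union, mem_ofPred_eq, not_or, not_exists, not_lt] at hcon
  obtain ⟨h1, h2⟩ := hcon
  refine (notMem_spectrum_iff_isUnit_sub _ z).mpr ?_ hz
  rw [ContinuousLinearMap.isUnit_iff_bijective,
    ContinuousLinearMap.bijective_iff_dense_range_and_antilipschitz]
  refine ⟨?_, ⟨ε⁻¹, inv_nonneg.mpr hε.le⟩, ?_⟩
  · rw [Submodule.topologicalClosure_eq_top_iff, Submodule.eq_bot_iff]
    intro y hy
    have hy' : ∀ x : EllTwo, inner ℂ (hoppingOp b x - z • x) y = 0 := fun x =>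
      (Submodule.mem_orthogonal _ _).mp hy _ ⟨x, sub_algebraMap_apply _ z x⟩
    obtain ⟨Y, hY, hYi⟩ := exists_flip y
    have hker : hoppingOp (fun k => b (-k - 1)) Y - z • Y = 0 := by
      refine lp.ext (funext fun i => ?_)
      rw [hoppingOp_sub_apply, show (Y : ℤ → ℂ) = _ from funext hYi,
        hopRes_eq_zero_of_forall_inner_eq_zero hy']
      rfl
    have h3 := h2 Y
    rw [hker, norm_zero, hY] at h3
    exact norm_le_zero_iff.mp (by nlinarith [norm_nonneg y])
  · refine AddMonoidHomClass.antilipschitz_of_bound _ fun x => ?_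
    rw [sub_algebraMap_apply]
    change ‖x‖ ≤ ε⁻¹ * _
    rw [inv_mul_eq_div, le_div_iff₀ hε, mul_comm]
    exact h1 x

theorem bigSigmaEps_eq {ε : ℝ} (hε : 0 < ε) :
    bigSigmaEps ε = ⋃ b : ℤ → ℤˣ, approxSpectrum ε (hoppingOp b) := by
  refine Subset.antisymm (iUnion_subset fun b z hz => ?_)
    (iUnion_mono fun b => approxSpectrum_subset_pseudospectrum _ hε)
  rw [mem_iUnion]
  rcases pseudospectrum_subset_union _ hε hz with h | h
  · rcases spectrum_hoppingOp_subset hε h with h | h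
    exacts [⟨_, h⟩, ⟨_, h⟩]
  · exact ⟨_, h⟩

/-! ### A sign sequence containing every finite word -/

/-- A sign sequence containing every finite word: the binary digits of `m` start at `m²`. -/
def universalSign (j : ℤ) : ℤˣ :=
  if (Nat.sqrt j.toNat).testBit (j.toNat - Nat.sqrt j.toNat ^ 2) then 1 else -1

theorem exists_universalSign_eq (N : ℕ) (c : ℕ → ℤˣ) :
    ∃ k : ℤ, ∀ i : ℕ, i < N → universalSign (k + i) = c i := by
  classical
  -- The extra bit 1 at position `N` forces `m ≥ 2^N > N`, so `m² + i` still has integer square root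
  -- `m` for `i < N`.
  set f : Fin (N + 1) → Bool := fun i => if (i : ℕ) = N then true else decide (c i = 1) with hf
  set m := Nat.ofBits f with hm
  have hbit : ∀ i (hi : i < N + 1), m.testBit i = f ⟨i, hi⟩ := fun i hi =>
    Nat.testBit_ofBits_lt f i hi
  have hmN : N < m := by
    have : m.testBit N = true := by rw [hbit N (by omega), hf]; simp
    exact Nat.lt_two_pow_self.trans_le (Nat.ge_two_pow_of_testBit this)
  refine ⟨(m ^ 2 : ℕ), fun i hi => ?_⟩
  have h1 : ((m ^ 2 : ℕ) + (i : ℤ)).toNat = m ^ 2 + i := by omega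
  have h2 : Nat.sqrt (m ^ 2 + i) = m := Nat.sqrt_add_eq' m (by omega)
  rw [universalSign, h1, h2, Nat.add_sub_cancel_left, hbit i (by omega), hf]
  simp only [hi.ne, if_false, decide_eq_true_eq]
  rcases Int.units_eq_one_or (c i) with h | h <;> simp [h]

/-- Finite truncations converge to `x`, and the strict inequality is an open condition. -/
theorem exists_finite_support_of_mem_approxSpectrum {b : ℤ → ℤˣ} {z : ℂ} {ε : ℝ}
    (h : z ∈ approxSpectrum ε (hoppingOp b)) :
    ∃ (s : Finset ℤ) (y : EllTwo), (∀ i ∉ s, y i = 0) ∧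
      ‖hoppingOp b y - z • y‖ < ε * ‖y‖ := by
  obtain ⟨x, hx⟩ := h
  have hs := lp.hasSum_single (p := 2) (by norm_num) x
  have ho : IsOpen {y : EllTwo | ‖hoppingOp b y - z • y‖ < ε * ‖y‖} :=
    isOpen_lt (by fun_prop) (by fun_prop)
  obtain ⟨s, hs⟩ := (Filter.Tendsto.eventually hs (ho.mem_nhds hx)).exists
  refine ⟨s, _, fun i hi => ?_, hs⟩
  rw [lp.coeFn_sum, Finset.sum_apply]
  refine Finset.sum_eq_zero fun j hj => lp.single_apply_ne _ _ _ ?_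
  rintro rfl
  exact hi hj

theorem approxSpectrum_subset_universalSign (b : ℤ → ℤˣ) (ε : ℝ) :
    approxSpectrum ε (hoppingOp b) ⊆ approxSpectrum ε (hoppingOp universalSign) := by
  intro z hz
  obtain ⟨s, y, hy, hlt⟩ := exists_finite_support_of_mem_approxSpectrum hz
  obtain ⟨N, hN⟩ : ∃ N : ℕ, ∀ i ∈ s, |i| < N := by
    refine ⟨∑ i ∈ s, i.natAbs + 1, fun i hi => ?_⟩
    have := Finset.single_le_sum (f := Int.natAbs) (fun _ _ => Nat.zero_le _) hi
    rw [Int.abs_eq_natAbs]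
    omega
  -- A word of length `2N` covers the positions from `-N` to `N - 1`, hence the support of `y`.
  -- Signs elsewhere only multiply zeros.
  obtain ⟨k, hk⟩ := exists_universalSign_eq (2 * N) fun i => b (i - N)
  have hk' : ∀ j, y j ≠ 0 → universalSign (j + (k + N)) = b j := by
    intro j hj
    have h1 := hN j (by by_contra h; exact hj (hy j h))
    rw [abs_lt] at h1
    have h2 := hk (j + N).toNat (by omega)
    rw [Int.toNat_of_nonneg (by omega)] at h2
    rw [show j + (k + N) = k + (j + N) by ring, h2]
    congr 1
    ring
  refine ⟨shift (k + N) y, ?_⟩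
  have h2 : ‖hoppingOp universalSign (shift (k + N) y) - z • shift (k + N) y‖ =
      ‖hoppingOp b y - z • y‖ := by
    refine norm_eq_of_norm_eq_shift (k + N) _ _ fun j => ?_
    rw [hoppingOp_sub_apply, hoppingOp_sub_apply, hopRes, hopRes]
    change ‖((universalSign (j - 1) : ℤ) : ℂ) * y (j - 1 - (k + N)) + y (j + 1 - (k + N)) -
      z * y (j - (k + N))‖ = _
    rw [show j - 1 - (k + N) = j - (k + N) - 1 by ring,
      show j + 1 - (k + N) = j - (k + N) + 1 by ring]
    by_cases h0 : y (j - (k + N) - 1) = 0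
    · rw [h0, mul_zero, mul_zero]
    · rw [← hk' _ h0]
      ring_nf
  rw [norm_shift, h2]
  exact hlt

/-! ### Reduction of the union to one operator -/

theorem bigSigmaEps_eq_approxSpectrum {ε : ℝ} (hε : 0 < ε) :
    bigSigmaEps ε = approxSpectrum ε (hoppingOp universalSign) := by
  rw [bigSigmaEps_eq hε]
  exact Subset.antisymm (iUnion_subset fun b => approxSpectrum_subset_universalSign b ε)
    (subset_iUnion (fun b => approxSpectrum ε (hoppingOp b)) _)

theorem bigSigma_subset_bigSigmaEps (ε : ℝ) : bigSigma ⊆ bigSigmaEps ε :=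
  iUnion_mono fun _ => subset_union_left

theorem mem_bigSigma_of_forall {z : ℂ} (h : ∀ δ, 0 < δ → z ∈ bigSigmaEps δ) : z ∈ bigSigma :=
  mem_iUnion.mpr ⟨universalSign, mem_spectrum_of_forall_mem_approxSpectrum fun δ hδ =>
    bigSigmaEps_eq_approxSpectrum hδ ▸ h δ hδ⟩

theorem bigSigmaEps_mono {δ ε : ℝ} (hδ : 0 < δ) (h : δ ≤ ε) : bigSigmaEps δ ⊆ bigSigmaEps ε := by
  rw [bigSigmaEps_eq_approxSpectrum hδ, bigSigmaEps_eq_approxSpectrum (hδ.trans_le h)]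
  exact approxSpectrum_mono _ h

theorem mem_bigSigmaEps_of_dist_le {z w : ℂ} {δ ε : ℝ} (hε : 0 < ε) (hδ : 0 ≤ δ)
    (h : z ∈ bigSigmaEps ε) (hw : dist w z ≤ δ) : w ∈ bigSigmaEps (ε + δ) := by
  rw [bigSigmaEps_eq_approxSpectrum hε] at h
  rw [bigSigmaEps_eq_approxSpectrum (by positivity)]
  exact mem_approxSpectrum_of_dist_le h hw

theorem isBounded_bigSigmaEps {ε : ℝ} (hε : 0 < ε) : Bornology.IsBounded (bigSigmaEps ε) := by
  refine (Metric.isBounded_closedBall (x := (0 : ℂ)) (r := 2 + ε)).subset fun z hz => ?_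
  rw [bigSigmaEps_eq_approxSpectrum hε] at hz
  rw [mem_closedBall_zero_iff]
  exact (norm_le_of_mem_approxSpectrum hz).trans (by gcongr; exact norm_hoppingOp_le _)

theorem mem_closure_bigSigmaEps {z : ℂ} {ε : ℝ} (hε : 0 < ε)
    (h : ∀ δ, 0 < δ → z ∈ bigSigmaEps (ε + δ)) : z ∈ closure (bigSigmaEps ε) := by
  by_cases hz : z ∈ spectrum ℂ (hoppingOp universalSign)
  · exact subset_closure (mem_iUnion.mpr ⟨_, Or.inl hz⟩)
  rw [bigSigmaEps_eq_approxSpectrum hε]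
  refine mem_closure_approxSpectrum hε hz fun δ hδ => ?_
  rw [← bigSigmaEps_eq_approxSpectrum (by positivity)]
  exact h δ hδ

/-- If the points that lie in all `Σ_{ε+δ}`, `δ > 0`, lie in an open set, then so does the closure
of some `Σ_{ε+δ}`. -/
theorem exists_closure_bigSigmaEps_subset {ε : ℝ} (hε : 0 ≤ ε) {U : Set ℂ} (hU : IsOpen U)
    (h : ∀ z, (∀ δ, 0 < δ → z ∈ bigSigmaEps (ε + δ)) → z ∈ U) :
    ∃ δ, 0 < δ ∧ closure (bigSigmaEps (ε + δ)) ⊆ U := by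
  have hp : ∀ m : ℕ, 0 < 1 / ((m : ℝ) + 1) := fun m => Nat.one_div_pos_of_nat
  -- The closures form a decreasing sequence of compact sets, so one of them already lies in any
  -- open set containing their intersection. Half of `δ` pays for the parameter, half for passing to
  -- the closure.
  have hanti : Antitone fun m : ℕ => closure (bigSigmaEps (ε + 1 / ((m : ℝ) + 1))) := by
    intro m k hmk
    have hk := hp k
    have := Nat.one_div_le_one_div (α := ℝ) hmk
    exact closure_mono (bigSigmaEps_mono (by positivity) (by linarith))
  obtain ⟨m, hm⟩ := exists_subset_nhds_of_isCompact
    (directed_of_isDirected_le hanti) (fun m => (isBounded_bigSigmaEps (by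
      have := hp m; positivity)).isCompact_closure) (U := U) fun z hz => by
      refine hU.mem_nhds (h z fun δ hδ => ?_)
      obtain ⟨m, hm⟩ := exists_nat_one_div_lt (half_pos hδ)
      have hz' := mem_iInter.mp hz m
      obtain ⟨w, hw, hzw⟩ := Metric.mem_closure_iff.mp hz' (δ / 2) (half_pos hδ)
      have hpm := hp m
      exact bigSigmaEps_mono (by positivity) (by linarith)
        (mem_bigSigmaEps_of_dist_le (by positivity) (half_pos hδ).le hw hzw.le)
  exact ⟨_, hp m, hm⟩

end BiInfinite

/-! ### Approximate eigenvectors of the matrices `A_n^c` -/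

section Finite

/-- Matrix index `j` stands for position `j + 1`. With zeros at positions `0` and `n + 1`, the
matrix acts by the bi-infinite recurrence. -/
theorem hoppingMatrix_mulVec (n : ℕ) (C : ℤ → ℤˣ) (X : ℤ → ℂ) (h0 : X 0 = 0)
    (hn : X (n + 1) = 0) (i : Fin n) :
    (hoppingMatrix n (fun j => C (j + 1))).mulVec (fun j => X (j + 1)) i =
      ((C i : ℤ) : ℂ) * X i + X (i + 2) := by
  have e : (hoppingMatrix n (fun j => C (j + 1))).mulVec (fun j => X (j + 1)) i =
      ∑ j : Fin n, ((if (j : ℕ) = i + 1 then X (j + 1) else 0) +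
        if (j : ℕ) + 1 = i then ((C (j + 1) : ℤ) : ℂ) * X (j + 1) else 0) := by
    rw [Matrix.mulVec, dotProduct]
    refine Finset.sum_congr rfl fun j _ => ?_
    simp only [hoppingMatrix, Matrix.of_apply]
    by_cases h1 : (j : ℕ) = i + 1
    · simp [h1, show ¬ (i : ℕ) + 1 + 1 = i by omega]
    · by_cases h2 : (i : ℕ) = j + 1
      · simp [h2, show ¬ (j : ℕ) = j + 1 + 1 by omega]
      · simp [h1, h2, show ¬ (j : ℕ) + 1 = i by omega]
  rw [e, Finset.sum_add_distrib, add_comm]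
  congr 1
  · by_cases hi : (i : ℕ) = 0
    · rw [hi, Nat.cast_zero, h0, mul_zero]
      exact Finset.sum_eq_zero fun j _ => if_neg (by omega)
    · rw [Finset.sum_eq_single (⟨i - 1, by omega⟩ : Fin n)]
      · rw [if_pos (Nat.sub_add_cancel (by omega)),
          show (((i : ℕ) - 1 : ℕ) : ℤ) + 1 = i by omega]
      · intro j _ hj
        refine if_neg fun h => hj (Fin.ext ?_)
        simp [← h]
      · simp
  · by_cases hi : (i : ℕ) + 1 = n
    · rw [show ((i : ℕ) : ℤ) + 2 = n + 1 by omega, hn]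
      exact Finset.sum_eq_zero fun j _ => if_neg (by omega)
    · rw [Finset.sum_eq_single (⟨i + 1, by omega⟩ : Fin n)]
      · rw [if_pos rfl]
        congr 1
      · intro j _ hj
        exact if_neg fun h => hj (Fin.ext h)
      · simp

theorem norm_sq_hoppingMatrix_sub (n : ℕ) (C : ℤ → ℤˣ) (z : ℂ) (X : ℤ → ℂ) (h0 : X 0 = 0)
    (hn : X (n + 1) = 0) :
    ‖Matrix.toEuclideanCLM (𝕜 := ℂ) (hoppingMatrix n (fun j => C (j + 1)))
        (WithLp.toLp 2 fun j : Fin n => X (j + 1)) -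
      z • WithLp.toLp 2 (fun j : Fin n => X (j + 1))‖ ^ 2 =
      ∑ i ∈ Finset.range n, ‖hopRes C z X (i + 1)‖ ^ 2 := by
  rw [EuclideanSpace.norm_sq_eq, Finset.sum_range]
  refine Finset.sum_congr rfl fun i _ => ?_
  rw [PiLp.sub_apply, PiLp.smul_apply, Matrix.toEuclideanCLM_toLp, PiLp.toLp_apply,
    PiLp.toLp_apply, hoppingMatrix_mulVec n C X h0 hn, hopRes, smul_eq_mul]
  rw [add_sub_cancel_right, show (i : ℤ) + 1 + 1 = i + 2 by ring]

theorem norm_sq_toLp (n : ℕ) (X : ℤ → ℂ) :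
    ‖(WithLp.toLp 2 fun j : Fin n => X (j + 1) : EuclideanSpace ℂ (Fin n))‖ ^ 2 =
      ∑ i ∈ Finset.range n, ‖X (i + 1)‖ ^ 2 := by
  rw [EuclideanSpace.norm_sq_eq, Finset.sum_range]

theorem lt_mul_iff_sq_lt {a b ε : ℝ} (ha : 0 ≤ a) (hb : 0 ≤ b) (hε : 0 < ε) :
    a < ε * b ↔ a ^ 2 < ε ^ 2 * b ^ 2 := by
  rw [← mul_pow, sq_lt_sq₀ ha (by positivity)]

theorem sigmaEps_eq (n : ℕ) {ε : ℝ} (hε : 0 < ε) :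
    sigmaEps n ε = ⋃ c : Fin (n - 1) → ℤˣ,
      approxSpectrum ε (Matrix.toEuclideanCLM (𝕜 := ℂ) (hoppingMatrix n c)) :=
  iUnion_congr fun _ => pseudospectrum_eq_of_finiteDimensional _ hε

theorem mem_sigmaEps_of_sum_lt {n : ℕ} {ε : ℝ} (hε : 0 < ε) {z : ℂ} (C : ℤ → ℤˣ)
    (X : ℤ → ℂ) (h0 : X 0 = 0) (hn : X (n + 1) = 0)
    (h : ∑ i ∈ Finset.range n, ‖hopRes C z X (i + 1)‖ ^ 2 <
      ε ^ 2 * ∑ i ∈ Finset.range n, ‖X (i + 1)‖ ^ 2) : z ∈ sigmaEps n ε := by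
  rw [sigmaEps_eq n hε, mem_iUnion]
  refine ⟨fun j => C (j + 1), WithLp.toLp 2 fun j : Fin n => X (j + 1), ?_⟩
  rw [lt_mul_iff_sq_lt (norm_nonneg _) (norm_nonneg _) hε,
    norm_sq_hoppingMatrix_sub n C z X h0 hn, norm_sq_toLp]
  exact h

theorem exists_of_mem_sigmaEps {n : ℕ} {ε : ℝ} (hε : 0 < ε) {z : ℂ} (h : z ∈ sigmaEps n ε) :
    ∃ (C : ℤ → ℤˣ) (X : ℤ → ℂ), (∀ i ≤ 0, X i = 0) ∧ (∀ i : ℤ, n + 1 ≤ i → X i = 0) ∧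
      ∑ i ∈ Finset.range n, ‖hopRes C z X (i + 1)‖ ^ 2 <
        ε ^ 2 * ∑ i ∈ Finset.range n, ‖X (i + 1)‖ ^ 2 := by
  rw [sigmaEps_eq n hε, mem_iUnion] at h
  obtain ⟨c, u, hu⟩ := h
  -- The filler sign 1 never matters: rows `1, …, n` use only `C 0, …, C (n - 1)`, and `C 0`
  -- multiplies `X 0 = 0`.
  set C : ℤ → ℤˣ := fun i =>
    if h : 1 ≤ i ∧ i ≤ n - 1 then c ⟨(i - 1).toNat, by omega⟩ else 1 with hC
  set X : ℤ → ℂ := fun i => if h : 1 ≤ i ∧ i ≤ n then u ⟨(i - 1).toNat, by omega⟩ else 0 with hX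
  have h1 : ∀ i ≤ 0, X i = 0 := fun i hi => dif_neg (by omega)
  have h2 : ∀ i : ℤ, n + 1 ≤ i → X i = 0 := fun i hi => dif_neg (by omega)
  refine ⟨C, X, h1, h2, ?_⟩
  have hc : c = fun j : Fin (n - 1) => C (j + 1) := by
    funext j
    have := j.isLt
    simp only [hC]
    rw [dif_pos (by omega)]
    congr 1
    ext
    simp
  have hxu : u = WithLp.toLp 2 fun j : Fin n => X (j + 1) := by
    ext j
    have := j.isLt
    simp only [hX]
    rw [dif_pos (by omega)]
    exact congrArg u (Fin.ext (by simp))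
  rw [← norm_sq_hoppingMatrix_sub n C z X (h1 0 le_rfl) (h2 _ le_rfl), ← norm_sq_toLp,
    ← lt_mul_iff_sq_lt (norm_nonneg _) (norm_nonneg _) hε, ← hc, ← hxu]
  exact hu

theorem sigma_subset_sigmaEps (n : ℕ) (ε : ℝ) : sigma n ⊆ sigmaEps n ε := by
  refine iUnion_mono fun c z hz => Or.inl ?_
  rwa [AlgEquiv.spectrum_eq]

/-! ### Finite sections inside the bi-infinite operators -/

/-- A finitely supported approximate solution, reflected with suitable signs at the right end of
its support. -/
theorem exists_reflection (z : ℂ) (m : ℤ) (hm : 0 < m) (C : ℤ → ℤˣ) (X : ℤ → ℂ)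
    (h0 : ∀ i ≤ 0, X i = 0) (h1 : ∀ i, m ≤ i → X i = 0) :
    ∃ (C' : ℤ → ℤˣ) (X' : ℤ → ℂ), (∀ i ≤ 0, X' i = 0) ∧ (∀ i, 2 * m ≤ i → X' i = 0) ∧
      X' 1 = X 1 ∧ ‖X' (2 * m - 1)‖ = ‖X 1‖ ∧
      ∑ i ∈ Finset.Ioo 0 (2 * m), ‖X' i‖ ^ 2 = 2 * ∑ i ∈ Finset.Ioo 0 m, ‖X i‖ ^ 2 ∧
      ∑ i ∈ Finset.Ioo 0 (2 * m), ‖hopRes C' z X' i‖ ^ 2 =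
        2 * ∑ i ∈ Finset.Ioo 0 m, ‖hopRes C z X i‖ ^ 2 := by
  -- Reflection swaps sub- and superdiagonal; the running product of signs is the diagonal
  -- conjugation that swaps them back. The leading minus makes the two neighbours of `m` cancel in
  -- row `m`.
  set s : ℤ → ℤˣ := fun i => -∏ t ∈ Finset.Ico (2 * m - i) m, C t with hs
  have hs1 : ∀ i, m ≤ i → s (i + 1) = s i * C (2 * m - i - 1) := by
    intro i hi
    simp only [hs]
    rw [neg_mul, neg_inj, show Finset.Ico (2 * m - (i + 1)) m =
      insert (2 * m - i - 1) (Finset.Ico (2 * m - i) m) by ext t; simp; omega,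
      Finset.prod_insert (by simp), mul_comm]
  have hsm : s m = -1 := by
    simp only [hs]
    rw [show 2 * m - m = m by ring, Finset.Ico_self, Finset.prod_empty]
  set C' : ℤ → ℤˣ := fun i => if i < m then C i else C (2 * m - 1 - i) with hC'
  set X' : ℤ → ℂ := fun i => if i < m then X i else ((s i : ℤ) : ℂ) * X (2 * m - i) with hX'
  have hXl : ∀ i ≤ m, X' i = X i := by
    intro i hi
    rcases hi.lt_or_eq with h | h
    · exact if_pos h
    · simp only [hX']
      rw [if_neg (by omega), h1 i h.ge, h1 (2 * m - i) (by omega), mul_zero]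
  have hXr : ∀ i, m ≤ i → X' i = ((s i : ℤ) : ℂ) * X (2 * m - i) := fun i hi => if_neg (by omega)
  have hnr : ∀ i, m ≤ i → ‖X' i‖ = ‖X (2 * m - i)‖ := fun i hi => by
    rw [hXr i hi, norm_sign_mul]
  have hrl : ∀ i < m, hopRes C' z X' i = hopRes C z X i := by
    intro i hi
    rw [hopRes, hopRes, hXl _ (by omega), hXl _ (by omega), hXl _ (by omega)]
    simp only [hC']
    rw [if_pos (by omega)]
  have hrm : hopRes C' z X' m = 0 := by
    rw [hopRes, hXl _ (by omega), hXr (m + 1) (by omega), hXl m le_rfl, h1 m le_rfl, hs1 m le_rfl,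
      hsm, show 2 * m - (m + 1) = m - 1 by ring, show 2 * m - m - 1 = m - 1 by ring]
    simp only [hC']
    rw [if_pos (by omega)]
    push_cast
    ring
  have hrr : ∀ i, m < i →
      hopRes C' z X' i = ((s i : ℤ) : ℂ) * hopRes C z X (2 * m - i) := by
    intro i hi
    have e1 := hs1 (i - 1) (by omega)
    rw [sub_add_cancel, show 2 * m - (i - 1) - 1 = 2 * m - i by ring] at e1
    have e2 : s (i - 1) * C (2 * m - i) = s i := e1.symm
    have e3 := hs1 i (by omega)
    rw [hopRes, hopRes, hXr _ (by omega), hXr _ (by omega), hXr _ (by omega), e3, ← e2]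
    simp only [hC']
    rw [if_neg (by omega), show 2 * m - 1 - (i - 1) = 2 * m - i by ring,
      show 2 * m - (i - 1) = 2 * m - i + 1 by ring, show 2 * m - (i + 1) = 2 * m - i - 1 by ring]
    push_cast
    ring
  have hnrr : ∀ i, m < i → ‖hopRes C' z X' i‖ = ‖hopRes C z X (2 * m - i)‖ := fun i hi => by
    rw [hrr i hi, norm_sign_mul]
  have hsplit : ∀ F G : ℤ → ℝ, (∀ i < m, F i = G i) → F m = 0 →
      (∀ i, m < i → F i = G (2 * m - i)) →
      ∑ i ∈ Finset.Ioo 0 (2 * m), F i = 2 * ∑ i ∈ Finset.Ioo 0 m, G i := by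
    intro F G hl hmid hr
    have hu : Finset.Ioo 0 (2 * m) = Finset.Ioo 0 m ∪ insert m (Finset.Ioo m (2 * m)) := by
      ext i; simp; omega
    rw [hu, Finset.sum_union, Finset.sum_insert (by simp), hmid, zero_add,
      two_mul (∑ i ∈ Finset.Ioo 0 m, G i)]
    · congr 1
      · exact Finset.sum_congr rfl fun i hi => hl i (Finset.mem_Ioo.mp hi).2
      · refine Finset.sum_bij' (fun i _ => 2 * m - i) (fun i _ => 2 * m - i) ?_ ?_ ?_ ?_ ?_
        · intro i hi; simp at hi ⊢; omega
        · intro i hi; simp at hi ⊢; omega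
        · intro i _; ring
        · intro i _; ring
        · intro i hi; exact hr i (Finset.mem_Ioo.mp hi).1
    · rw [Finset.disjoint_left]
      intro i hi
      simp at hi ⊢
      omega
  refine ⟨C', X', fun i hi => ?_, fun i hi => ?_, hXl 1 (by omega), ?_, ?_, ?_⟩
  · rw [hXl i (by omega), h0 i hi]
  · rw [hXr i (by omega), h0 _ (by omega), mul_zero]
  · rw [hnr _ (by omega)]
    congr 2
    ring
  · refine hsplit _ _ (fun i hi => by rw [hXl i hi.le]) ?_ fun i hi => by rw [hnr i hi.le]
    rw [hXl m le_rfl, h1 m le_rfl, norm_zero, zero_pow two_ne_zero]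
  · refine hsplit _ _ (fun i hi => by rw [hrl i hi]) ?_ fun i hi => by rw [hnrr i hi]
    rw [hrm, norm_zero, zero_pow two_ne_zero]

theorem exists_iterated_reflection (z : ℂ) (m : ℤ) (hm : 0 < m) (C : ℤ → ℤˣ) (X : ℤ → ℂ)
    (h0 : ∀ i ≤ 0, X i = 0) (h1 : ∀ i, m ≤ i → X i = 0) (k : ℕ) :
    ∃ (M : ℤ) (C' : ℤ → ℤˣ) (X' : ℤ → ℂ), 0 < M ∧
      (∀ i ≤ 0, X' i = 0) ∧ (∀ i, M ≤ i → X' i = 0) ∧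
      ‖X' 1‖ ≤ ‖X 1‖ + ‖X (m - 1)‖ ∧ ‖X' (M - 1)‖ ≤ ‖X 1‖ + ‖X (m - 1)‖ ∧
      ∑ i ∈ Finset.Ioo 0 M, ‖X' i‖ ^ 2 = 2 ^ k * ∑ i ∈ Finset.Ioo 0 m, ‖X i‖ ^ 2 ∧
      ∑ i ∈ Finset.Ioo 0 M, ‖hopRes C' z X' i‖ ^ 2 =
        2 ^ k * ∑ i ∈ Finset.Ioo 0 m, ‖hopRes C z X i‖ ^ 2 := by
  induction k with
  | zero => exact ⟨m, C, X, hm, h0, h1, by simp, by simp, by simp, by simp⟩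
  | succ k ih =>
    obtain ⟨M, C', X', hM, a0, a1, a2, a3, a4, a5⟩ := ih
    obtain ⟨C'', X'', b0, b1, b2, b3, b4, b5⟩ := exists_reflection z M hM C' X' a0 a1
    -- After a reflection both end values have the modulus of the left one, so the bound `a2` serves
    -- twice.
    refine ⟨2 * M, C'', X'', by omega, b0, b1, b2 ▸ a2, b3 ▸ a2, ?_, ?_⟩
    · rw [b4, a4]; ring
    · rw [b5, a5]; ring

/-- Outside the support only rows `0` and `M` have a residual, of moduli `‖X 1‖` and `‖X (M - 1)‖`.
-/
theorem mem_approxSpectrum_of_finite_support {ε : ℝ} (hε : 0 < ε) {z : ℂ} {M : ℤ} (hM : 0 < M)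
    (C : ℤ → ℤˣ) (X : ℤ → ℂ) (h0 : ∀ i ≤ 0, X i = 0) (h1 : ∀ i, M ≤ i → X i = 0)
    (h : ∑ i ∈ Finset.Ioo 0 M, ‖hopRes C z X i‖ ^ 2 + ‖X 1‖ ^ 2 + ‖X (M - 1)‖ ^ 2 <
      ε ^ 2 * ∑ i ∈ Finset.Ioo 0 M, ‖X i‖ ^ 2) : z ∈ approxSpectrum ε (hoppingOp C) := by
  have hfin : ∀ i ∉ Finset.Ioo 0 M, X i = 0 := fun i hi => by
    rw [Finset.mem_Ioo, not_and_or, not_lt, not_lt] at hi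
    exact hi.elim (h0 i) (h1 i)
  have hmem : Memℓp X 2 := by
    refine (memℓp_zero ((Finset.finite_toSet (Finset.Ioo 0 M)).subset fun i hi => ?_)).of_exponent_ge
      zero_le
    by_contra hcon
    exact hi (hfin i hcon)
  set x : EllTwo := ⟨X, hmem⟩ with hx
  have hxX : ∀ i, x i = X i := fun _ => rfl
  refine ⟨x, ?_⟩
  rw [lt_mul_iff_sq_lt (norm_nonneg _) (norm_nonneg _) hε]
  have e1 : ‖x‖ ^ 2 = ∑ i ∈ Finset.Ioo 0 M, ‖X i‖ ^ 2 := by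
    refine (hasSum_norm_sq x).unique (hasSum_sum_of_ne_finset_zero fun i hi => ?_)
    rw [hxX, hfin i hi, norm_zero, zero_pow two_ne_zero]
  have hr0 : hopRes C z X 0 = X 1 := by
    rw [hopRes, h0 (0 - 1) (by norm_num), h0 0 le_rfl]
    simp
  have hrM : ‖hopRes C z X M‖ = ‖X (M - 1)‖ := by
    rw [hopRes, h1 M le_rfl, h1 (M + 1) (by omega), add_zero, mul_zero, sub_zero, norm_sign_mul]
  have e2 : ‖hoppingOp C x - z • x‖ ^ 2 =
      ∑ i ∈ Finset.Ioo 0 M, ‖hopRes C z X i‖ ^ 2 + ‖X 1‖ ^ 2 + ‖X (M - 1)‖ ^ 2 := by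
    have hs := hasSum_norm_sq_hopRes C z x 0
    simp only [add_zero] at hs
    have hs2 : HasSum (fun k => ‖hopRes C z X k‖ ^ 2)
        (∑ i ∈ insert 0 (insert M (Finset.Ioo 0 M)), ‖hopRes C z X i‖ ^ 2) := by
      refine hasSum_sum_of_ne_finset_zero fun i hi => ?_
      simp only [Finset.mem_insert, Finset.mem_Ioo, not_or, not_and, not_lt] at hi
      have hi' : i < 0 ∨ M < i := by omega
      have : hopRes C z X i = 0 := by
        rcases hi' with hi' | hi'
        · rw [hopRes, h0 i (by omega), h0 (i - 1) (by omega), h0 (i + 1) (by omega)]; simp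
        · rw [hopRes, h1 i (by omega), h1 (i - 1) (by omega), h1 (i + 1) (by omega)]; simp
      rw [this, norm_zero, zero_pow two_ne_zero]
    rw [hs.unique hs2, Finset.sum_insert (by simp; omega), Finset.sum_insert (by simp), hr0, hrM]
    ring
  rw [e1, e2]
  exact h

theorem sigmaEps_subset_bigSigmaEps (n : ℕ) {ε : ℝ} (hε : 0 < ε) :
    sigmaEps n ε ⊆ bigSigmaEps ε := by
  intro z hz
  obtain ⟨C, X, h0, h1, hlt⟩ := exists_of_mem_sigmaEps hε hz
  have hsum : ∀ F : ℤ → ℝ, ∑ i ∈ Finset.range n, F (i + 1) =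
      ∑ i ∈ Finset.Ioo 0 ((n : ℤ) + 1), F i := by
    intro F
    refine Finset.sum_bij' (fun i _ => (i : ℤ) + 1) (fun i _ => (i - 1).toNat) ?_ ?_ ?_ ?_ ?_
    · intro i hi; simp at hi ⊢; omega
    · intro i hi; simp at hi ⊢; omega
    · intro i _; simp
    · intro i hi; simp at hi ⊢; omega
    · intro i _; rfl
  rw [hsum fun i => ‖hopRes C z X i‖ ^ 2, hsum fun i => ‖X i‖ ^ 2] at hlt
  set R := ∑ i ∈ Finset.Ioo 0 ((n : ℤ) + 1), ‖hopRes C z X i‖ ^ 2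
  set S := ∑ i ∈ Finset.Ioo 0 ((n : ℤ) + 1), ‖X i‖ ^ 2
  set e := ‖X 1‖ + ‖X ((n : ℤ) + 1 - 1)‖ with he
  -- Reflection multiplies the gap `ε²S - R` by `2^k`, while the two end defects together stay at
  -- most `2e²`.
  obtain ⟨k, hk⟩ := pow_unbounded_of_one_lt (2 * e ^ 2 / (ε ^ 2 * S - R)) one_lt_two
  rw [div_lt_iff₀ (sub_pos.mpr hlt)] at hk
  obtain ⟨M, C', X', hM, a0, a1, a2, a3, a4, a5⟩ :=
    exists_iterated_reflection z ((n : ℤ) + 1) (by omega) C X h0 h1 k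
  rw [bigSigmaEps_eq hε, mem_iUnion]
  refine ⟨C', mem_approxSpectrum_of_finite_support hε hM C' X' a0 a1 ?_⟩
  rw [a4, a5]
  have b2 : ‖X' 1‖ ^ 2 ≤ e ^ 2 := pow_le_pow_left₀ (norm_nonneg _) a2 2
  have b3 : ‖X' (M - 1)‖ ^ 2 ≤ e ^ 2 := pow_le_pow_left₀ (norm_nonneg _) a3 2
  linarith

end Finite

/-! ### Localization of approximate eigenvectors to windows of length `n` -/

section Window

/-- Convexity of the square with weights `ε/(ε+η)` and `η/(ε+η)`. This split balances: squared sizes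
`ε²` and `η²` add up to `(ε+η)²`. -/
theorem norm_add_add_sq_le {ε η : ℝ} (hε : 0 < ε) (hη : 0 < η) (a p q : ℂ) :
    ‖a + (p + q)‖ ^ 2 ≤
      (ε + η) / ε * ‖a‖ ^ 2 + (ε + η) / η * (2 * (‖p‖ ^ 2 + ‖q‖ ^ 2)) := by
  have h1 : ‖a + (p + q)‖ ≤ ‖a‖ + ‖p + q‖ := norm_add_le _ _
  have h2 : ‖p + q‖ ^ 2 ≤ 2 * (‖p‖ ^ 2 + ‖q‖ ^ 2) :=
    (pow_le_pow_left₀ (norm_nonneg _) (norm_add_le p q) 2).trans add_sq_le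
  have h3 : (‖a‖ + ‖p + q‖) ^ 2 ≤
      (ε + η) / ε * ‖a‖ ^ 2 + (ε + η) / η * ‖p + q‖ ^ 2 := by
    rw [← sub_nonneg, show (ε + η) / ε * ‖a‖ ^ 2 + (ε + η) / η * ‖p + q‖ ^ 2 -
      (‖a‖ + ‖p + q‖) ^ 2 = (η * ‖a‖ - ε * ‖p + q‖) ^ 2 / (ε * η) by field_simp; ring]
    positivity
  calc ‖a + (p + q)‖ ^ 2 ≤ (‖a‖ + ‖p + q‖) ^ 2 := by gcongr
    _ ≤ _ := h3
    _ ≤ _ := by gcongr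

/-- A product rule: the error terms are the commutator of the weight with the two shifts. -/
theorem hopRes_weighted (b : ℤ → ℤˣ) (z : ℂ) (x : ℤ → ℂ) (w : ℤ → ℝ) (k i : ℤ) :
    hopRes (fun j => b (k + j)) z (fun j => (w j : ℂ) * x (k + j)) (i + 1) =
      (w (i + 1) : ℂ) * hopRes b z x (k + (i + 1)) +
        (((b (k + i) : ℤ) : ℂ) * (((w i - w (i + 1) : ℝ) : ℂ) * x (k + i)) +
          ((w (i + 2) - w (i + 1) : ℝ) : ℂ) * x (k + (i + 2))) := by
  simp only [hopRes]
  rw [show i + 1 - 1 = i by ring, show i + 1 + 1 = i + 2 by ring,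
    show k + (i + 1) - 1 = k + i by ring, show k + (i + 1) + 1 = k + (i + 2) by ring]
  push_cast
  ring

theorem norm_sq_hopRes_weighted_le {ε η : ℝ} (hε : 0 < ε) (hη : 0 < η) (b : ℤ → ℤˣ) (z : ℂ)
    (x : ℤ → ℂ) (w : ℤ → ℝ) (k i : ℤ) :
    ‖hopRes (fun j => b (k + j)) z (fun j => (w j : ℂ) * x (k + j)) (i + 1)‖ ^ 2 ≤
      (ε + η) / ε * (w (i + 1) ^ 2 * ‖hopRes b z x (k + (i + 1))‖ ^ 2) +
        (ε + η) / η * (2 * ((w i - w (i + 1)) ^ 2 * ‖x (k + i)‖ ^ 2 +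
          (w (i + 2) - w (i + 1)) ^ 2 * ‖x (k + (i + 2))‖ ^ 2)) := by
  rw [hopRes_weighted]
  refine (norm_add_add_sq_le hε hη _ _ _).trans_eq ?_
  rw [norm_sign_mul]
  simp only [norm_mul, Complex.norm_real, mul_pow, Real.norm_eq_abs, sq_abs]

/-- Weights `w` on a window of length `n` localize approximate eigenvectors of `A^b` to the
window, at the cost of increasing the relative residual by `η`. -/
theorem approxSpectrum_subset_sigmaEps_of_weights {n : ℕ} {w : ℤ → ℝ} (h0 : w 0 = 0)
    (hn : w (n + 1) = 0) {η : ℝ} (hη : 0 < η)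
    (hS : 0 < ∑ i ∈ Finset.range n, w (i + 1) ^ 2)
    (hT : ∑ i ∈ Finset.range n, 2 * ((w i - w (i + 1)) ^ 2 + (w (i + 2) - w (i + 1)) ^ 2) =
      η ^ 2 * ∑ i ∈ Finset.range n, w (i + 1) ^ 2)
    (b : ℤ → ℤˣ) {ε : ℝ} (hε : 0 < ε) :
    approxSpectrum ε (hoppingOp b) ⊆ sigmaEps n (ε + η) := by
  rintro z ⟨x, hx⟩
  by_contra hcon
  set S := ∑ i ∈ Finset.range n, w (i + 1) ^ 2
  have hk : ∀ k : ℤ, (ε + η) ^ 2 * ∑ i ∈ Finset.range n, w (i + 1) ^ 2 * ‖x (k + (i + 1))‖ ^ 2 ≤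
      ∑ i ∈ Finset.range n, ((ε + η) / ε * (w (i + 1) ^ 2 * ‖hopRes b z x (k + (i + 1))‖ ^ 2) +
        (ε + η) / η * (2 * ((w i - w (i + 1)) ^ 2 * ‖x (k + i)‖ ^ 2 +
          (w (i + 2) - w (i + 1)) ^ 2 * ‖x (k + (i + 2))‖ ^ 2))) := by
    intro k
    have h1 : ¬ _ := fun h => hcon (mem_sigmaEps_of_sum_lt (by positivity : 0 < ε + η)
      (fun j => b (k + j)) (fun j => (w j : ℂ) * x (k + j)) (by simp [h0]) (by simp [hn]) h)
    refine le_trans (le_of_eq_of_le ?_ (not_lt.mp h1))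
      (Finset.sum_le_sum fun i _ => norm_sq_hopRes_weighted_le hε hη b z x w k i)
    congr 1
    refine Finset.sum_congr rfl fun i _ => ?_
    rw [norm_mul, mul_pow, Complex.norm_real, Real.norm_eq_abs, sq_abs]
  -- Summed over all window positions `k`, each row of the window sees the full norm of `x`, so only
  -- sums of weights remain.
  have hL : HasSum (fun k : ℤ => (ε + η) ^ 2 *
      ∑ i ∈ Finset.range n, w (i + 1) ^ 2 * ‖x (k + (i + 1))‖ ^ 2)
      ((ε + η) ^ 2 * ∑ i ∈ Finset.range n, w (i + 1) ^ 2 * ‖x‖ ^ 2) :=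
    (hasSum_sum fun i _ => (hasSum_norm_sq_shift x _).mul_left _).mul_left _
  have hR := hasSum_sum (s := Finset.range n) fun i _ =>
    (((hasSum_norm_sq_hopRes b z x ((i : ℤ) + 1)).mul_left (w (i + 1) ^ 2)).mul_left
      ((ε + η) / ε)).add
    (((((hasSum_norm_sq_shift x i).mul_left ((w i - w (i + 1)) ^ 2)).add
      ((hasSum_norm_sq_shift x (i + 2)).mul_left ((w (i + 2) - w (i + 1)) ^ 2))).mul_left
        2).mul_left ((ε + η) / η))
  have hle := hasSum_le hk hL hR
  set r := ‖hoppingOp b x - z • x‖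
  have e1 : (ε + η) ^ 2 * ∑ i ∈ Finset.range n, w (i + 1) ^ 2 * ‖x‖ ^ 2 =
      (ε + η) * (ε + η) * S * ‖x‖ ^ 2 := by
    rw [← Finset.sum_mul]; ring
  have e2 : ∑ i ∈ Finset.range n, ((ε + η) / ε * (w (i + 1) ^ 2 * r ^ 2) +
        (ε + η) / η * (2 * ((w i - w (i + 1)) ^ 2 * ‖x‖ ^ 2 +
          (w (i + 2) - w (i + 1)) ^ 2 * ‖x‖ ^ 2))) =
      (ε + η) / ε * S * r ^ 2 + (ε + η) * η * S * ‖x‖ ^ 2 := by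
    have e3 : (ε + η) * η * S * ‖x‖ ^ 2 = (ε + η) / η * ‖x‖ ^ 2 * (η ^ 2 * S) := by
      field_simp
    rw [e3, ← hT, Finset.sum_add_distrib, Finset.mul_sum, Finset.mul_sum, Finset.sum_mul]
    congr 1
    · exact Finset.sum_congr rfl fun i _ => by ring
    · exact Finset.sum_congr rfl fun i _ => by ring
  rw [e1, e2] at hle
  have h3 : r ^ 2 < ε ^ 2 * ‖x‖ ^ 2 :=
    (lt_mul_iff_sq_lt (norm_nonneg _) (norm_nonneg _) hε).mp hx
  have h4 : (ε + η) / ε * S * r ^ 2 < (ε + η) / ε * S * (ε ^ 2 * ‖x‖ ^ 2) := by gcongr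
  have h5 : (ε + η) / ε * S * (ε ^ 2 * ‖x‖ ^ 2) = (ε + η) * ε * S * ‖x‖ ^ 2 := by
    field_simp
  have h6 : (ε + η) * (ε + η) * S * ‖x‖ ^ 2 =
      (ε + η) * ε * S * ‖x‖ ^ 2 + (ε + η) * η * S * ‖x‖ ^ 2 := by ring
  linarith

/-! ### The optimal weights -/

theorem theta_pos {n : ℕ} (hn : 1 ≤ n) : 0 < theta n :=
  lt_trans (by positivity) (isTheta_theta n hn).1.1

theorem theta_le {n : ℕ} (hn : 1 ≤ n) : theta n ≤ Real.pi / (2 * ((n : ℝ) + 2)) :=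
  (isTheta_theta n hn).1.2

theorem mul_theta_le {n : ℕ} (hn : 1 ≤ n) : ((n : ℝ) + 2) * theta n ≤ Real.pi / 2 := by
  have h := theta_le hn
  rw [le_div_iff₀ (by positivity)] at h
  linarith

theorem epsSeq_pos {n : ℕ} (hn : 1 ≤ n) : 0 < epsSeq n := by
  have h1 := theta_pos hn
  have h2 := mul_theta_le hn
  have h3 : (0 : ℝ) ≤ n * theta n := by positivity
  exact mul_pos (by norm_num)
    (Real.sin_pos_of_pos_of_lt_pi h1 (by linarith [Real.pi_pos]))

theorem epsSeq_le {n : ℕ} (hn : 1 ≤ n) : epsSeq n ≤ 2 * Real.pi / ((n : ℝ) + 2) := by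
  calc epsSeq n ≤ 4 * theta n := by
        rw [epsSeq]; gcongr; exact Real.sin_le (theta_pos hn).le
    _ ≤ 4 * (Real.pi / (2 * ((n : ℝ) + 2))) := by gcongr; exact theta_le hn
    _ = _ := by field_simp; ring

theorem tendsto_epsSeq : Tendsto epsSeq atTop (𝓝 0) := by
  have h : Tendsto (fun n : ℕ => 2 * Real.pi / ((n : ℝ) + 2)) atTop (𝓝 0) :=
    tendsto_const_nhds.div_atTop (tendsto_atTop_add_const_right _ _ tendsto_natCast_atTop_atTop)
  refine tendsto_of_tendsto_of_tendsto_of_le_of_le' tendsto_const_nhds h ?_ ?_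
  · filter_upwards [eventually_ge_atTop 1] with n hn using (epsSeq_pos hn).le
  · filter_upwards [eventually_ge_atTop 1] with n hn using epsSeq_le hn

/-- The weights `cos((2i - n - 1)θ_n)` on `{1, …, n}`. -/
noncomputable def weight (n : ℕ) (i : ℤ) : ℝ :=
  if 1 ≤ i ∧ i ≤ n then Real.cos ((2 * i - n - 1) * theta n) else 0

theorem weight_sum_pos {n : ℕ} (hn : 1 ≤ n) :
    0 < ∑ i ∈ Finset.range n, weight n (i + 1) ^ 2 := by
  refine Finset.sum_pos' (fun i _ => sq_nonneg _) ⟨0, Finset.mem_range.mpr hn, ?_⟩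
  have h1 := theta_pos hn
  have h2 := mul_theta_le hn
  have h3 : (1 : ℝ) ≤ n := by exact_mod_cast hn
  have : 0 < weight n ((0 : ℕ) + 1) := by
    rw [weight, if_pos (by omega)]
    refine Real.cos_pos_of_mem_Ioo ⟨?_, ?_⟩ <;> push_cast <;> nlinarith
  positivity

/-- The weights form an eigenvector of the quadratic form that bounds the localization error. -/
theorem weight_sum_eq {n : ℕ} (hn : 1 ≤ n) :
    ∑ i ∈ Finset.range n, 2 * ((weight n i - weight n (i + 1)) ^ 2 +
        (weight n (i + 2) - weight n (i + 1)) ^ 2) =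
      epsSeq n ^ 2 * ∑ i ∈ Finset.range n, weight n (i + 1) ^ 2 := by
  set θ := theta n with hθ
  set v : ℕ → ℝ := fun i => Real.cos ((2 * i - n - 1) * θ) with hv
  -- The eigenvalue identity holds termwise up to differences of `G`, which telescope to zero
  -- because `G` vanishes at `0` and `n`.
  set G : ℕ → ℝ := fun i => if i = 0 ∨ i = n then 0 else v (i + 1) ^ 2 - v i ^ 2 with hG
  have hw : ∀ i : ℕ, 1 ≤ i → i ≤ n → weight n i = v i := fun i h1 h2 => by
    rw [weight, if_pos (by omega)]
    simp [hv, hθ]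
  -- Here `1 - 2 sin²θ = cos 2θ`, and `2(4 - 4 cos 2θ) = 16 sin²θ = ε_n²` is the eigenvalue.
  have hrec : ∀ i, v i + v (i + 2) = 2 * (1 - 2 * Real.sin θ ^ 2) * v (i + 1) := by
    intro i
    have e1 : (2 * ((i : ℕ) : ℝ) - n - 1) * θ =
        (2 * ((i + 1 : ℕ) : ℝ) - n - 1) * θ - 2 * θ := by push_cast; ring
    have e2 : (2 * ((i + 2 : ℕ) : ℝ) - n - 1) * θ =
        (2 * ((i + 1 : ℕ) : ℝ) - n - 1) * θ + 2 * θ := by push_cast; ring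
    simp only [hv]
    rw [e1, e2, Real.cos_sub, Real.cos_add, Real.cos_two_mul, Real.cos_sq']
    ring
  have hbase := (isTheta_theta n hn).2
  have hleft : v 1 = 2 * v 0 := by
    simp only [hv]
    rw [← Real.cos_neg, ← Real.cos_neg ((2 * ((0 : ℕ) : ℝ) - n - 1) * θ)]
    -- The equation defining `θ_n` is the natural boundary condition: the form counts interior
    -- differences twice but the end jumps once.
    convert hbase.symm using 3 <;> push_cast <;> ring
  have hright : v n = 2 * v (n + 1) := by
    simp only [hv]
    convert hbase.symm using 3 <;> push_cast <;> ring
  have hterm : ∀ i ∈ Finset.range n, 2 * ((weight n i - weight n (i + 1)) ^ 2 +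
        (weight n (i + 2) - weight n (i + 1)) ^ 2) =
      epsSeq n ^ 2 * weight n (i + 1) ^ 2 + 2 * (G (i + 1) - G i) := by
    intro i hi
    rw [Finset.mem_range] at hi
    have h1 : weight n (i + 1) = v (i + 1) := by exact_mod_cast hw (i + 1) (by omega) (by omega)
    have hr : v (i + 2) = 2 * (1 - 2 * Real.sin θ ^ 2) * v (i + 1) - v i := by
      linarith [hrec i]
    have hl : (weight n i - v (i + 1)) ^ 2 =
        (v i - v (i + 1)) ^ 2 + (v (i + 1) ^ 2 - v i ^ 2 - G i) := by
      by_cases h : i = 0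
      · subst h
        rw [weight, if_neg (by omega)]
        simp only [hG, true_or, if_true, zero_add]
        rw [hleft]
        ring
      · rw [hw i (by omega) (by omega)]
        simp [hG, h, hi.ne]
    have hr' : (weight n (i + 2) - v (i + 1)) ^ 2 =
        (v (i + 2) - v (i + 1)) ^ 2 - (v (i + 2) ^ 2 - v (i + 1) ^ 2 - G (i + 1)) := by
      by_cases h : i + 1 = n
      · rw [weight, if_neg (by omega)]
        have hr2 : v (i + 1) = 2 * v (i + 2) := by
          rw [show i + 2 = n + 1 by omega, h]; exact hright
        simp only [hG, h, or_true, if_true]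
        rw [h] at hr2
        rw [hr2]
        ring
      · have := hw (i + 2) (by omega) (by omega)
        push_cast at this
        rw [this]
        simp [hG, h]
    rw [h1, hl, hr', epsSeq, ← hθ]
    have : (v i - v (i + 1)) ^ 2 + (v (i + 2) - v (i + 1)) ^ 2 =
        (v i ^ 2 + v (i + 2) ^ 2 + 2 * v (i + 1) ^ 2) - 2 * v (i + 1) * (v i + v (i + 2)) := by
      ring
    rw [hrec i] at this
    linear_combination 2 * this
  rw [Finset.sum_congr rfl hterm, Finset.sum_add_distrib, ← Finset.mul_sum, ← Finset.mul_sum,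
    Finset.sum_range_sub]
  simp [hG]

theorem bigSigmaEps_subset_sigmaEps {n : ℕ} (hn : 1 ≤ n) {ε : ℝ} (hε : 0 < ε) :
    bigSigmaEps ε ⊆ sigmaEps n (ε + epsSeq n) := by
  rw [bigSigmaEps_eq hε]
  exact iUnion_subset fun b => approxSpectrum_subset_sigmaEps_of_weights
    (if_neg (by omega)) (if_neg (by omega)) (epsSeq_pos hn) (weight_sum_pos hn)
    (weight_sum_eq hn) b hε

end Window

/-! ### Inclusions and convergence -/

section Main

theorem sigma_subset_bigSigma (n : ℕ) : sigma n ⊆ bigSigma := fun _ hz =>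
  mem_bigSigma_of_forall fun δ hδ =>
    sigmaEps_subset_bigSigmaEps n hδ (sigma_subset_sigmaEps n δ hz)

/-- For each `n` there are finitely many sign vectors, so one of them serves infinitely many
excesses `1/(m+1)`; the absence of plateaus then applies to that one matrix. -/
theorem bigSigma_subset_closure_sigmaEps {n : ℕ} (hn : 1 ≤ n) :
    bigSigma ⊆ closure (sigmaEps n (epsSeq n)) := by
  intro z hz
  have hpos := epsSeq_pos hn
  rw [sigmaEps_eq n hpos]
  have h1 : ∀ m : ℕ, ∃ c : Fin (n - 1) → ℤˣ, z ∈ approxSpectrum (epsSeq n + 1 / ((m : ℝ) + 1))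
      (Matrix.toEuclideanCLM (𝕜 := ℂ) (hoppingMatrix n c)) := by
    intro m
    have hm : 0 < 1 / ((m : ℝ) + 1) := Nat.one_div_pos_of_nat
    have h2 := bigSigmaEps_subset_sigmaEps hn hm (bigSigma_subset_bigSigmaEps _ hz)
    rwa [add_comm, sigmaEps_eq n (by positivity), mem_iUnion] at h2
  choose c hc using h1
  obtain ⟨c₀, hc₀⟩ := Finite.exists_infinite_fiber c
  have h3 : ∀ δ, 0 < δ → z ∈ approxSpectrum (epsSeq n + δ)
      (Matrix.toEuclideanCLM (𝕜 := ℂ) (hoppingMatrix n c₀)) := by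
    intro δ hδ
    obtain ⟨k, hk⟩ := exists_nat_one_div_lt hδ
    obtain ⟨m, hm, hkm⟩ := (infinite_coe_iff.mp hc₀).exists_gt k
    have hm' : c m = c₀ := hm
    have := Nat.one_div_le_one_div (α := ℝ) hkm.le
    exact hm' ▸ approxSpectrum_mono _ (by linarith) (hc m)
  refine closure_mono (subset_iUnion _ c₀) ?_
  by_cases hs : z ∈ spectrum ℂ (Matrix.toEuclideanCLM (𝕜 := ℂ) (hoppingMatrix n c₀))
  · rw [← pseudospectrum_eq_of_finiteDimensional _ hpos]
    exact subset_closure (Or.inl hs)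
  · exact mem_closure_approxSpectrum hpos hs h3

theorem sigma_add_ball_subset (n : ℕ) (ε : ℝ) :
    sigma n + Metric.ball (0 : ℂ) ε ⊆ bigSigmaEps ε := by
  rintro _ ⟨z, hz, w, hw, rfl⟩
  rw [mem_ball_zero_iff] at hw
  have h1 := bigSigma_subset_bigSigmaEps (ε - ‖w‖) (sigma_subset_bigSigma n hz)
  have h2 := mem_bigSigmaEps_of_dist_le (w := z + w) (δ := ‖w‖) (sub_pos.mpr hw) (norm_nonneg w)
    h1 (by simp)
  rwa [sub_add_cancel] at h2

/-! ### Hausdorff convergence -/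

theorem tendsto_hausdorffEDist_zero {T : ℕ → Set ℂ} {S : Set ℂ}
    (h : ∀ η, 0 < η → ∀ᶠ n in atTop, T n ⊆ Metric.thickening η S ∧ S ⊆ Metric.thickening η (T n)) :
    Tendsto (fun n => Metric.hausdorffEDist (T n) S) atTop (𝓝 0) := by
  rw [ENNReal.tendsto_atTop_zero]
  intro ρ hρ
  obtain ⟨η, hη, hηρ⟩ : ∃ η : ℝ, 0 < η ∧ ENNReal.ofReal η ≤ ρ := by
    rcases eq_or_ne ρ ⊤ with rfl | hρ'
    · exact ⟨1, one_pos, le_top⟩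
    · exact ⟨ρ.toReal, ENNReal.toReal_pos hρ.ne' hρ', ENNReal.ofReal_toReal_le⟩
  obtain ⟨N, hN⟩ := eventually_atTop.mp (h η hη)
  refine ⟨N, fun n hn => (Metric.hausdorffEDist_le_of_infEDist ?_ ?_).trans hηρ⟩
  · exact fun x hx => (Metric.mem_thickening_iff_infEDist_lt.mp ((hN n hn).1 hx)).le
  · exact fun x hx => (Metric.mem_thickening_iff_infEDist_lt.mp ((hN n hn).2 hx)).le

theorem eventually_epsSeq_lt {δ : ℝ} (hδ : 0 < δ) :
    ∀ᶠ n in atTop, 1 ≤ n ∧ epsSeq n < δ :=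
  (eventually_ge_atTop 1).and (tendsto_epsSeq.eventually (gt_mem_nhds hδ))

theorem decreasesTo_bigSigma :
    DecreasesTo (fun n => closure (sigmaEps n (epsSeq n))) bigSigma := by
  refine ⟨fun n hn => bigSigma_subset_closure_sigmaEps hn,
    tendsto_hausdorffEDist_zero fun η hη => ?_⟩
  obtain ⟨δ, hδ, hsub⟩ := exists_closure_bigSigmaEps_subset le_rfl
    (Metric.isOpen_thickening (δ := η) (E := bigSigma)) fun z hz =>
      Metric.self_subset_thickening hη _
        (mem_bigSigma_of_forall fun δ hδ => by simpa using hz δ hδ)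
  filter_upwards [eventually_epsSeq_lt hδ] with n ⟨hn, hlt⟩
  refine ⟨?_, (bigSigma_subset_closure_sigmaEps hn).trans (Metric.self_subset_thickening hη _)⟩
  refine (closure_mono ((sigmaEps_subset_bigSigmaEps n (epsSeq_pos hn)).trans
    (bigSigmaEps_mono (epsSeq_pos hn) ?_))).trans hsub
  linarith

theorem decreasesTo_bigSigmaEps {ε : ℝ} (hε : 0 < ε) :
    DecreasesTo (fun n => sigmaEps n (ε + epsSeq n)) (bigSigmaEps ε) := by
  refine ⟨fun n hn => bigSigmaEps_subset_sigmaEps hn hε,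
    tendsto_hausdorffEDist_zero fun η hη => ?_⟩
  obtain ⟨δ, hδ, hsub⟩ := exists_closure_bigSigmaEps_subset hε.le
    (Metric.isOpen_thickening (δ := η) (E := bigSigmaEps ε)) fun z hz =>
      Metric.closure_subset_thickening hη _ (mem_closure_bigSigmaEps hε hz)
  filter_upwards [eventually_epsSeq_lt hδ] with n ⟨hn, hlt⟩
  refine ⟨?_, (bigSigmaEps_subset_sigmaEps hn hε).trans (Metric.self_subset_thickening hη _)⟩
  have hpos := epsSeq_pos hn
  exact (sigmaEps_subset_bigSigmaEps n (by positivity)).trans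
    ((bigSigmaEps_mono (by positivity) (by linarith)).trans (subset_closure.trans hsub))

/-- A point of `Σ_ε` lies in `Σ_δ` for some smaller `δ`. -/
theorem exists_mem_bigSigmaEps_sub {z : ℂ} {ε : ℝ} (hε : 0 < ε) (hz : z ∈ bigSigmaEps ε) :
    ∃ δ, 0 < δ ∧ δ < ε ∧ z ∈ bigSigmaEps (ε - δ) := by
  rw [bigSigmaEps_eq_approxSpectrum hε] at hz
  obtain ⟨x, hx⟩ := hz
  have hx0 : 0 < ‖x‖ := pos_of_mul_pos_right ((norm_nonneg _).trans_lt hx) hε.le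
  rw [← div_lt_iff₀ hx0] at hx
  obtain ⟨a, ha, haε⟩ := exists_between hx
  have ha0 : 0 < a := lt_of_le_of_lt (by positivity) ha
  refine ⟨ε - a, by linarith, by linarith, ?_⟩
  rw [sub_sub_cancel, bigSigmaEps_eq_approxSpectrum ha0]
  exact ⟨x, (div_lt_iff₀ hx0).mp ha⟩

theorem bigSigmaEps_sub_subset_sigmaEps {n : ℕ} (hn : 1 ≤ n) {ε : ℝ} (hε : epsSeq n < ε) :
    bigSigmaEps (ε - epsSeq n) ⊆ sigmaEps n ε := by
  have h := bigSigmaEps_subset_sigmaEps hn (sub_pos.mpr hε)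
  rwa [sub_add_cancel] at h

theorem increasesTo_bigSigmaEps {ε : ℝ} (hε : 0 < ε) :
    IncreasesTo (fun n => sigmaEps n ε) (bigSigmaEps ε) := by
  refine ⟨fun n _ => sigmaEps_subset_bigSigmaEps n hε,
    tendsto_hausdorffEDist_zero fun η hη => ?_⟩
  -- The net lies in `Σ_ε` itself, so each of its finitely many points has slack `δ`, and `ε_n`
  -- eventually drops below all of these.
  obtain ⟨t, htS, htf, hcov⟩ := Metric.finite_approx_of_totallyBounded
    ((isBounded_bigSigmaEps hε).isCompact_closure.totallyBounded.subset subset_closure) η hη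
  have hev : ∀ᶠ n in atTop, ∀ y ∈ t, y ∈ sigmaEps n ε := by
    rw [eventually_all_finite htf]
    intro y hy
    obtain ⟨δ, hδ, hδε, hyδ⟩ := exists_mem_bigSigmaEps_sub hε (htS hy)
    filter_upwards [eventually_epsSeq_lt hδ] with n ⟨hn, hlt⟩
    exact bigSigmaEps_sub_subset_sigmaEps hn (hlt.trans hδε)
      (bigSigmaEps_mono (sub_pos.mpr hδε) (by linarith) hyδ)
  filter_upwards [hev] with n hn
  refine ⟨(sigmaEps_subset_bigSigmaEps n hε).trans (Metric.self_subset_thickening hη _),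
    fun z hz => ?_⟩
  obtain ⟨y, hy, hzy⟩ := mem_iUnion₂.mp (hcov hz)
  exact Metric.mem_thickening_iff.mpr ⟨y, hn y hy, hzy⟩

end Main

end HoppingSign

theorem theorem4p9 :
    -- the bound on `ε_n`
    (∀ n : ℕ, 1 ≤ n →
      0 < HoppingSign.epsSeq n ∧ HoppingSign.epsSeq n ≤ 2 * Real.pi / ((n : ℝ) + 2)) ∧
    -- inclusions for the spectrum
    (∀ n : ℕ, 1 ≤ n →
      HoppingSign.sigma n ⊆ HoppingSign.bigSigma ∧
      HoppingSign.bigSigma ⊆ closure (HoppingSign.sigmaEps n (HoppingSign.epsSeq n)) ∧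
      closure (HoppingSign.sigmaEps n (HoppingSign.epsSeq n)) ⊆
        closure (HoppingSign.bigSigmaEps (HoppingSign.epsSeq n))) ∧
    -- inclusions for the pseudospectrum
    (∀ n : ℕ, 1 ≤ n → ∀ ε : ℝ, 0 < ε →
      HoppingSign.bigSigmaEps ε ⊆ HoppingSign.sigmaEps n (ε + HoppingSign.epsSeq n) ∧
      HoppingSign.sigmaEps n (ε + HoppingSign.epsSeq n) ⊆
        HoppingSign.bigSigmaEps (ε + HoppingSign.epsSeq n)) ∧
    (∀ n : ℕ, 1 ≤ n → ∀ ε : ℝ, 0 < ε →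
      HoppingSign.sigma n + Metric.ball (0 : ℂ) ε ⊆ HoppingSign.bigSigmaEps ε) ∧
    (∀ n : ℕ, 1 ≤ n → ∀ ε : ℝ, HoppingSign.epsSeq n < ε →
      HoppingSign.bigSigmaEps (ε - HoppingSign.epsSeq n) ⊆ HoppingSign.sigmaEps n ε ∧
      HoppingSign.sigmaEps n ε ⊆ HoppingSign.bigSigmaEps ε) ∧
    -- convergence as `n → ∞`
    HoppingSign.DecreasesTo
      (fun n => closure (HoppingSign.sigmaEps n (HoppingSign.epsSeq n)))
      HoppingSign.bigSigma ∧
    (∀ ε : ℝ, 0 < ε →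
      HoppingSign.DecreasesTo
        (fun n => HoppingSign.sigmaEps n (ε + HoppingSign.epsSeq n))
        (HoppingSign.bigSigmaEps ε) ∧
      HoppingSign.IncreasesTo
        (fun n => HoppingSign.sigmaEps n ε)
        (HoppingSign.bigSigmaEps ε)) := by
  open HoppingSign in
  exact ⟨fun n hn => ⟨epsSeq_pos hn, epsSeq_le hn⟩,
    fun n hn => ⟨sigma_subset_bigSigma n, bigSigma_subset_closure_sigmaEps hn,
      closure_mono (sigmaEps_subset_bigSigmaEps n (epsSeq_pos hn))⟩,
    fun n hn ε hε => ⟨bigSigmaEps_subset_sigmaEps hn hε,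
      sigmaEps_subset_bigSigmaEps n (add_pos hε (epsSeq_pos hn))⟩,
    fun n _ ε _ => sigma_add_ball_subset n ε,
    fun n hn ε hε => ⟨bigSigmaEps_sub_subset_sigmaEps hn hε,
      sigmaEps_subset_bigSigmaEps n ((epsSeq_pos hn).trans hε)⟩,
    decreasesTo_bigSigma,
    fun ε hε => ⟨decreasesTo_bigSigmaEps hε, increasesTo_bigSigmaEps hε⟩⟩
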